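/- Let $M$ be an $n$-dimensional smooth manifold (Hausdorff, second countable, without boundary) equipped with a smooth positive density $\mathrm{vol}$, let $E\to M$ and $F\to M$ be smooth real vector bundles of finite rank with dual bundles $E^*$, $F^*$, and fix a smooth Riemannian metric on $E$ with fibrewise norm $|\cdot|$. Let $L:C^\infty(M,E)\to C^\infty(M,F)$ be a linear differential operator of order $k\in\mathbb N$ (with smooth coefficients), with formally dual operator $L^*:C^\infty(M,F^*)\to C^\infty(M,E^*)$, i.e. the linear differential operator such that $\int_M\langle Lu,\varphi\rangle\,\mathrm{vol}=\int_M\langle u,L^*\varphi\rangle\,\mathrm{vol}$ for all $u\in C^\infty(M,E)$, $\varphi\in C^\infty(M,F^*)$ for which $\operatorname{supp}u\cap\operatorname{supp}\varphi$ is compact. For $\Omega\subset M$ open, let $\mathcal D'(\Omega,E)$ be the space of continuous linear functionals on the space $\mathcal D(\Omega,E^*)$ of compactly supported smooth sections of $E^*$ over $\Omega$; for $T\in\mathcal D'(\Omega,E)$ define $LT$ by $(LT)[\varphi]=T[L^*\varphi]$ for $\varphi\in\mathcal D(\Omega,F^*)$. Assume that $L$ is weakly hypoelliptic: for every open $\Omega\subset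 M$, every $T\in\mathcal D'(\Omega,E)$ with $LT=0$ is smooth, i.e. is given by $T[\varphi]=\int_\Omega\langle s,\varphi\rangle\,\mathrm{vol}$ for some $s\in C^\infty(\Omega,E)$. Let $\mathcal H(M,L)=\{u\in C^\infty(M,E): Lu=0\}$. Let $A\subset M$ be a set of uniqueness for $L$: every $u\in\mathcal H(M,L)$ with $u|_A=0$ is identically $0$. Let $u_1,u_2,\ldots\in\mathcal H(M,L)$ be a sequence which is locally $L^1$-bounded, i.e. $\sup_j\int_K|u_j|\,\mathrm{vol}<\infty$ for every compact $K\subset M$, and suppose that $\lim_{j\to\infty}u_j(x)$ exists in $E_x$ for every $x\in A$. Then there is $u\in\mathcal H(M,L)$ such that $u_j\to u$ in the $C^\infty$-topology, i.e. in local coordinates and local trivializations the $u_j$ converge to $u$ locally uniformly together with all derivatives. -/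

import Mathlib

open Set Filter Topology MeasureTheory Bundle
open scoped Manifold ContDiff Bundle NNReal

noncomputable section

/-! Throughout, `M` is a smooth `n`-dimensional manifold (without boundary, modelled on
`EuclideanSpace ℝ (Fin n)`) and `E → M`, `F → M` are smooth real vector bundles of finite rank with
model fibres `V`, `W`. -/

section OneBundle

variable {n : ℕ} {M : Type*} [TopologicalSpace M] [ChartedSpace (EuclideanSpace ℝ (Fin n)) M]
  (V : Type*) [NormedAddCommGroup V] [NormedSpace ℝ V]
  (E : M → Type*) [TopologicalSpace (TotalSpace V E)] [∀ x, AddCommGroup (E x)]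
  [∀ x, Module ℝ (E x)] [∀ x, TopologicalSpace (E x)] [FiberBundle V E]

/-- The space `C^∞(M, E)` of smooth sections. -/
abbrev SmoothSec : Type _ := Cₛ^∞⟮𝓡 n; V, E⟯

/-- The fibre at `x` of the dual bundle `E^*`; its model fibre is `V →L[ℝ] ℝ`, and its bundle
structure is Mathlib's bundle of continuous linear maps from `E` to the trivial line bundle. -/
abbrev DualBundle (x : M) : Type _ := E x →L[ℝ] Bundle.Trivial M ℝ x

variable {E}

/-- The coordinate representation `ℝⁿ → V` of a section of `E` in the chart and the
trivialization around `x₀`. It is meaningful on `coordDomain V E x₀`. -/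
def coordRep (x₀ : M) (s : ∀ x, E x) (y : EuclideanSpace ℝ (Fin n)) : V :=
  (trivializationAt V E x₀
    ⟨(chartAt (EuclideanSpace ℝ (Fin n)) x₀).symm y,
      s ((chartAt (EuclideanSpace ℝ (Fin n)) x₀).symm y)⟩).2

variable (E)

/-- The open subset of `ℝⁿ` corresponding, under the chart around `x₀`, to the points of `M` lying
both in the domain of that chart and in the base set of the trivialization of `E` around `x₀`. -/
def coordDomain (x₀ : M) : Set (EuclideanSpace ℝ (Fin n)) :=
  (chartAt (EuclideanSpace ℝ (Fin n)) x₀).target ∩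
    (chartAt (EuclideanSpace ℝ (Fin n)) x₀).symm ⁻¹' (trivializationAt V E x₀).baseSet

variable {E}

/-- Convergence in the `C^∞`-topology: in local coordinates and local trivializations, the
sections together with all their derivatives converge locally uniformly. -/
def TendstoCInfty (u : ℕ → SmoothSec (n := n) V E) (u₀ : SmoothSec (n := n) V E) : Prop :=
  ∀ (x₀ : M) (m : ℕ),
    TendstoLocallyUniformlyOn
      (fun j => iteratedFDeriv ℝ m (coordRep V x₀ (u j)))
      (iteratedFDeriv ℝ m (coordRep (n := n) V x₀ u₀)) atTop (coordDomain V E x₀)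


end OneBundle

/-- The support of a section: the closure of the set of points where it does not vanish. -/
def secSupport {M : Type*} [TopologicalSpace M] {E : M → Type*} [∀ x, AddCommGroup (E x)]
    (s : ∀ x, E x) : Set M :=
  closure {x | s x ≠ 0}

/-- A measure `μ` on `M` is (integration against) a smooth positive density: in each chart it is
a smooth positive function times Lebesgue measure. -/
def IsSmoothPositiveDensity (n : ℕ) {M : Type*} [TopologicalSpace M]
    [ChartedSpace (EuclideanSpace ℝ (Fin n)) M] [MeasurableSpace M] (μ : Measure M) : Prop :=
  ∀ x₀ : M, ∃ ρ : EuclideanSpace ℝ (Fin n) → ℝ,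
    ContDiffOn ℝ ∞ ρ (chartAt (EuclideanSpace ℝ (Fin n)) x₀).target ∧
    (∀ y ∈ (chartAt (EuclideanSpace ℝ (Fin n)) x₀).target, 0 < ρ y) ∧
    ∀ B ⊆ (chartAt (EuclideanSpace ℝ (Fin n)) x₀).source, MeasurableSet B →
      μ B = ∫⁻ y in chartAt (EuclideanSpace ℝ (Fin n)) x₀ '' B, ENNReal.ofReal (ρ y)

section Bundles

variable {n : ℕ} {M : Type*} [TopologicalSpace M] [ChartedSpace (EuclideanSpace ℝ (Fin n)) M]
  (V : Type*) [NormedAddCommGroup V] [NormedSpace ℝ V]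
  (E : M → Type*) [TopologicalSpace (TotalSpace V E)] [∀ x, AddCommGroup (E x)]
  [∀ x, Module ℝ (E x)] [∀ x, TopologicalSpace (E x)] [FiberBundle V E] [VectorBundle ℝ V E]
  (W : Type*) [NormedAddCommGroup W] [NormedSpace ℝ W]
  (F : M → Type*) [TopologicalSpace (TotalSpace W F)] [∀ x, AddCommGroup (F x)]
  [∀ x, Module ℝ (F x)] [∀ x, TopologicalSpace (F x)] [FiberBundle W F] [VectorBundle ℝ W F]

/-- The space `𝒟(Ω, E)` of smooth sections with compact support contained in `Ω`. -/
def TestSec (Ω : Set M) : Submodule ℝ (SmoothSec (n := n) V E) where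
  carrier := {φ | IsCompact (secSupport φ) ∧ secSupport φ ⊆ Ω}
  zero_mem' := by
    simp [secSupport]
  add_mem' := by
    rintro φ ψ ⟨hφ, hφ'⟩ ⟨hψ, hψ'⟩
    have h : secSupport (φ + ψ : SmoothSec (n := n) V E) ⊆ secSupport φ ∪ secSupport ψ := by
      unfold secSupport
      rw [← closure_union]
      refine closure_mono fun x hx => ?_
      by_contra hc
      simp only [mem_union, mem_ofPred_eq, not_or, not_not] at hc
      exact hx (by simp [hc.1, hc.2])
    exact ⟨(hφ.union hψ).of_isClosed_subset isClosed_closure h, h.trans (union_subset hφ' hψ')⟩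
  smul_mem' := by
    rintro c φ ⟨hφ, hφ'⟩
    have h : secSupport (c • φ : SmoothSec (n := n) V E) ⊆ secSupport φ := by
      refine closure_mono fun x hx => ?_
      intro hc
      exact hx (by simp [hc])
    exact ⟨hφ.of_isClosed_subset isClosed_closure h, h.trans hφ'⟩

/-- The space `𝒟'(Ω, E)` of distributional sections of `E` over `Ω`: the linear functionals on
`𝒟(Ω, E^*)` that are continuous, in the sense that `T φ_j → T φ` whenever the supports of the
`φ_j` lie in a common compact subset of `Ω` and `φ_j → φ` with all derivatives. -/
structure DistribSec (Ω : Set M) where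
  toLin : TestSec (n := n) (V →L[ℝ] ℝ) (DualBundle E) Ω →ₗ[ℝ] ℝ
  tendsto' : ∀ (φ : ℕ → TestSec (n := n) (V →L[ℝ] ℝ) (DualBundle E) Ω)
    (φ₀ : TestSec (n := n) (V →L[ℝ] ℝ) (DualBundle E) Ω) (K : Set M),
    IsCompact K → K ⊆ Ω → (∀ j, secSupport (φ j).1 ⊆ K) →
    TendstoCInfty (n := n) (V →L[ℝ] ℝ) (fun j => (φ j).1) φ₀.1 →
    Tendsto (fun j => toLin (φ j)) atTop (𝓝 (toLin φ₀))

variable {V E W F}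

/-- `T ∈ 𝒟'(Ω, E)` is smooth: it is given by integration against a smooth section of `E|_Ω`. -/
def DistribSec.IsSmooth [MeasurableSpace M] (μ : Measure M) {Ω : Set M}
    (T : DistribSec (n := n) V E Ω) : Prop :=
  ∃ s : ∀ x, E x,
    ContMDiffOn (𝓡 n) ((𝓡 n).prod 𝓘(ℝ, V)) ∞ (fun x => TotalSpace.mk' V x (s x)) Ω ∧
    ∀ φ : TestSec (n := n) (V →L[ℝ] ℝ) (DualBundle E) Ω,
      T.toLin φ = ∫ x, φ.1 x (s x) ∂μ

/-- `L` is a linear differential operator of order (at most) `k`: in local coordinates,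
`L u = ∑_{m ≤ k} a_m (D^m u)` with smooth coefficients `a_m`, where `D^m u` is the total `m`-th
derivative and `a_m` takes values in the linear maps from `V`-valued `m`-linear forms on `ℝⁿ`
to `W`. -/
def IsDiffOp (k : ℕ) (L : SmoothSec (n := n) V E →ₗ[ℝ] SmoothSec (n := n) W F) : Prop :=
  ∀ x₀ : M, ∃ a : ∀ m : ℕ, EuclideanSpace ℝ (Fin n) →
      ((EuclideanSpace ℝ (Fin n) [×m]→L[ℝ] V) →L[ℝ] W),
    (∀ m, ContDiffOn ℝ ∞ (a m) (coordDomain V E x₀ ∩ coordDomain W F x₀)) ∧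
    ∀ u : SmoothSec (n := n) V E, ∀ y ∈ coordDomain V E x₀ ∩ coordDomain W F x₀,
      coordRep W x₀ (L u) y =
        ∑ m ∈ Finset.range (k + 1), a m y (iteratedFDeriv ℝ m (coordRep V x₀ u) y)

/-- `L'` is the formally dual operator of `L`: a linear differential operator
`C^∞(M, F^*) → C^∞(M, E^*)` with `∫ ⟨L u, φ⟩ = ∫ ⟨u, L' φ⟩` whenever `supp u ∩ supp φ` is
compact. -/
def IsFormalDual [MeasurableSpace M] (μ : Measure M)
    (L : SmoothSec (n := n) V E →ₗ[ℝ] SmoothSec (n := n) W F)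
    (L' : SmoothSec (n := n) (W →L[ℝ] ℝ) (DualBundle F) →ₗ[ℝ]
      SmoothSec (n := n) (V →L[ℝ] ℝ) (DualBundle E)) : Prop :=
  (∃ k, IsDiffOp k L') ∧
  ∀ (u : SmoothSec (n := n) V E) (φ : SmoothSec (n := n) (W →L[ℝ] ℝ) (DualBundle F)),
    IsCompact (secSupport u ∩ secSupport φ) →
      ∫ x, φ x (L u x) ∂μ = ∫ x, L' φ x (u x) ∂μ

theorem trivializationAt_snd_eq_zero_iff (x₀ : M) {b : M}
    (hb : b ∈ (trivializationAt V E x₀).baseSet) (v : E b) :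
    (trivializationAt V E x₀ ⟨b, v⟩).2 = 0 ↔ v = 0 := by
  have h := ((trivializationAt V E x₀).continuousLinearEquivAt ℝ b hb).map_eq_zero_iff (x := v)
  rwa [Trivialization.continuousLinearEquivAt_apply] at h

/-- A differential operator does not increase supports. -/
theorem secSupport_subset_of_isDiffOp {k : ℕ}
    {L : SmoothSec (n := n) V E →ₗ[ℝ] SmoothSec (n := n) W F} (hL : IsDiffOp k L)
    (u : SmoothSec (n := n) V E) : secSupport (L u) ⊆ secSupport u := by
  refine closure_minimal (fun x₀ hx => ?_) isClosed_closure
  by_contra hc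
  apply hx
  obtain ⟨a, -, ha⟩ := hL x₀
  set c := chartAt (EuclideanSpace ℝ (Fin n)) x₀ with hcdef
  have hxs : x₀ ∈ c.source := mem_chart_source _ x₀
  have hy : c x₀ ∈ coordDomain V E x₀ ∩ coordDomain W F x₀ := by
    refine ⟨⟨c.map_source hxs, ?_⟩, ⟨c.map_source hxs, ?_⟩⟩ <;>
    · simp only [mem_preimage, ← hcdef, c.left_inv hxs]
      exact FiberBundle.mem_baseSet_trivializationAt' x₀
  have hcont : ContinuousAt c.symm (c x₀) := c.continuousAt_symm (c.map_source hxs)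
  have hnhds : c.symm ⁻¹' ((secSupport u)ᶜ ∩ (trivializationAt V E x₀).baseSet) ∈ 𝓝 (c x₀) := by
    apply hcont.preimage_mem_nhds
    rw [c.left_inv hxs]
    exact Filter.inter_mem (isClosed_closure.isOpen_compl.mem_nhds hc)
      ((trivializationAt V E x₀).open_baseSet.mem_nhds
        (FiberBundle.mem_baseSet_trivializationAt' x₀))
  have hzero : coordRep (n := n) V x₀ u =ᶠ[𝓝 (c x₀)] fun _ => (0 : V) := by
    filter_upwards [hnhds] with y hy
    have h0 : u (c.symm y) = 0 := by
      by_contra h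
      exact hy.1 (subset_closure h)
    exact (trivializationAt_snd_eq_zero_iff x₀ hy.2 _).2 h0
  have h1 := ha u (c x₀) hy
  have h2 : coordRep W x₀ (L u) (c x₀) = 0 := by
    rw [h1]
    refine Finset.sum_eq_zero fun m _ => ?_
    rw [(hzero.iteratedFDeriv ℝ m).eq_of_nhds]
    simp
  have h3 := (trivializationAt_snd_eq_zero_iff x₀ hy.2.2 _).1 h2
  rwa [c.left_inv hxs] at h3

open Classical in
/-- The formally dual operator `L^*` of the differential operator `L`. (It exists and is unique; the
default value below is never used for a differential operator.) -/
def formalDual [MeasurableSpace M] (μ : Measure M)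
    (L : SmoothSec (n := n) V E →ₗ[ℝ] SmoothSec (n := n) W F) :
    SmoothSec (n := n) (W →L[ℝ] ℝ) (DualBundle F) →ₗ[ℝ]
      SmoothSec (n := n) (V →L[ℝ] ℝ) (DualBundle E) :=
  if h : ∃ L', IsFormalDual μ L L' then h.choose else 0

theorem formalDual_spec [MeasurableSpace M] {μ : Measure M}
    {L : SmoothSec (n := n) V E →ₗ[ℝ] SmoothSec (n := n) W F}
    (h : ∃ L', IsFormalDual μ L L') : IsFormalDual μ L (formalDual μ L) := by
  rw [formalDual, dif_pos h]
  exact h.choose_spec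

theorem exists_isDiffOp_formalDual [MeasurableSpace M] (μ : Measure M)
    (L : SmoothSec (n := n) V E →ₗ[ℝ] SmoothSec (n := n) W F) :
    ∃ k, IsDiffOp k (formalDual μ L) := by
  by_cases h : ∃ L', IsFormalDual μ L L'
  · exact (formalDual_spec h).1
  · rw [formalDual, dif_neg h]
    refine ⟨0, fun x₀ => ⟨fun _ _ => 0, fun _ => contDiffOn_const, fun u y hy => ?_⟩⟩
    simpa [coordRep] using
      (trivializationAt_snd_eq_zero_iff (V := V →L[ℝ] ℝ) (E := DualBundle E) x₀ hy.2.2 0).2 rfl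

/-- `L^*` as a map `𝒟(Ω, F^*) → 𝒟(Ω, E^*)`. -/
def formalDualTest [MeasurableSpace M] (μ : Measure M)
    (L : SmoothSec (n := n) V E →ₗ[ℝ] SmoothSec (n := n) W F) (Ω : Set M) :
    TestSec (n := n) (W →L[ℝ] ℝ) (DualBundle F) Ω →ₗ[ℝ]
      TestSec (n := n) (V →L[ℝ] ℝ) (DualBundle E) Ω :=
  (formalDual μ L).restrict fun φ hφ => by
    obtain ⟨k, hk⟩ := exists_isDiffOp_formalDual μ L
    have h := secSupport_subset_of_isDiffOp hk φ
    exact ⟨hφ.1.of_isClosed_subset isClosed_closure h, h.trans hφ.2⟩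

/-- The distribution `L T`, `(L T)[φ] = T[L^* φ]`, as a linear functional on `𝒟(Ω, F^*)`. -/
def DistribSec.applyOp [MeasurableSpace M] (μ : Measure M)
    (L : SmoothSec (n := n) V E →ₗ[ℝ] SmoothSec (n := n) W F) {Ω : Set M}
    (T : DistribSec (n := n) V E Ω) :
    TestSec (n := n) (W →L[ℝ] ℝ) (DualBundle F) Ω →ₗ[ℝ] ℝ :=
  T.toLin ∘ₗ formalDualTest μ L Ω

/-- `L` is weakly hypoelliptic: for every open `Ω ⊆ M`, every `T ∈ 𝒟'(Ω, E)` with `L T = 0` is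
smooth. -/
def WeaklyHypoelliptic [MeasurableSpace M] (μ : Measure M)
    (L : SmoothSec (n := n) V E →ₗ[ℝ] SmoothSec (n := n) W F) : Prop :=
  ∀ Ω : Set M, IsOpen Ω → ∀ T : DistribSec (n := n) V E Ω, T.applyOp μ L = 0 → T.IsSmooth μ

/-- The solution space `ℋ(M, L)`: the smooth sections `u` with `L u = 0`. -/
def solutionSpace (L : SmoothSec (n := n) V E →ₗ[ℝ] SmoothSec (n := n) W F) :
    Submodule ℝ (SmoothSec (n := n) V E) :=
  LinearMap.ker L

/-- `A` is a set of uniqueness for `L`: a solution on `M` vanishing on `A` is zero. -/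
def IsSetOfUniqueness (L : SmoothSec (n := n) V E →ₗ[ℝ] SmoothSec (n := n) W F) (A : Set M) :
    Prop :=
  ∀ u ∈ solutionSpace L, (∀ x ∈ A, u x = 0) → u = 0

/-- The sequence `u` is locally `L¹`-bounded: `sup_j ∫_K |u_j| dμ < ∞` for each compact `K ⊆ M`,
where `|·|` is the norm on the fibres of `E` given by the Riemannian metric `g`. -/
def LocallyL1Bounded [MeasurableSpace M] (μ : Measure M)
    [∀ x, IsTopologicalAddGroup (E x)] [∀ x, ContinuousConstSMul ℝ (E x)]
    (g : ContMDiffRiemannianMetric (𝓡 n) ∞ V E) (u : ℕ → SmoothSec (n := n) V E) : Prop :=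
  ∀ K : Set M, IsCompact K → ∃ C : ℝ≥0, ∀ j,
    ∫⁻ x in K, ENNReal.ofReal √(g.inner x (u j x) (u j x)) ∂μ ≤ C

end Bundles

end

/-! The proof is a Montel argument combined with uniqueness of limits.

Interior estimate (`WeaklyHypoelliptic.exists_norm_iteratedFDeriv_coordRep_le`). On a small
coordinate ball, distributional solutions form a closed subspace `N` of `L¹`, since pairing with a
fixed test section is `L¹`-continuous. Thus `N` is a Banach space, and weak hypoellipticity says
that its elements have smooth representatives. Each representative is bounded, with all its
derivatives, on a smaller ball, and Banach–Steinhaus makes these bounds uniform on the unit ball of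
`N`. For values it is applied to averages over small open sets, which are continuous functionals on
`L¹`. For derivatives it is applied, inductively on the order, to difference quotients.

Compactness (`LocallyCInftyBounded.exists_tendsto_ultrafilter`). A locally `L¹`-bounded sequence of
solutions therefore has locally bounded derivatives of every order. Finite-dimensional compactness
gives limits of all derivatives along any ultrafilter. Bounds on higher derivatives make the limits
compatible with differentiation, so the limit is a smooth section, and it is again a solution.

Uniqueness. Limits along two ultrafilters finer than `atTop` agree on `A`, where the sequence
converges, so they agree everywhere because their difference is a solution. Hence all derivatives
converge pointwise along the whole sequence, and locally uniformly by the Lipschitz bounds. -/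

/-! ### Calculus: limits and bounds of iterated derivatives -/

section LocalAnalysis

variable {X V : Type*} [NormedAddCommGroup X] [NormedAddCommGroup V]

/-- Pointwise convergence of a locally uniformly Lipschitz family is locally uniform. -/
theorem tendstoLocallyUniformlyOn_of_locally_lipschitz {ι : Type*} {l : Filter ι} [l.NeBot]
    {f : ι → X → V} {g : X → V} {s : Set X}
    (hlip : ∀ x ∈ s, ∃ t ∈ 𝓝 x, ∃ K : ℝ, ∀ i, ∀ y ∈ t, ‖f i y - f i x‖ ≤ K * ‖y - x‖)
    (hlim : ∀ x ∈ s, Tendsto (fun i => f i x) l (𝓝 (g x))) :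
    TendstoLocallyUniformlyOn f g l s := by
  rw [Metric.tendstoLocallyUniformlyOn_iff]
  intro ε hε x hx
  obtain ⟨t, ht, K, hK⟩ := hlip x hx
  -- The limit inherits the Lipschitz bound at `x`, so `g y - f i y` splits into two oscillation
  -- terms and the error at `x`, each at most `ε / 3`.
  have hg : ∀ y ∈ t ∩ s, ‖g y - g x‖ ≤ K * ‖y - x‖ := fun y hy =>
    le_of_tendsto ((hlim y hy.2).sub (hlim x hx)).norm (Eventually.of_forall fun i => hK i y hy.1)
  have hsmall : ∀ᶠ y in 𝓝 x, K * ‖y - x‖ < ε / 3 := by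
    have : Tendsto (fun y => K * ‖y - x‖) (𝓝 x) (𝓝 (K * ‖x - x‖)) :=
      (Continuous.tendsto (by fun_prop) x)
    exact this.eventually_lt_const (by simpa using by positivity)
  refine ⟨t ∩ {y | K * ‖y - x‖ < ε / 3} ∩ s, ?_, ?_⟩
  · exact inter_mem (mem_nhdsWithin_of_mem_nhds (inter_mem ht hsmall)) self_mem_nhdsWithin
  filter_upwards [Metric.tendsto_nhds.1 (hlim x hx) (ε / 3) (by positivity)] with i hi y hy
  have h1 := hg y ⟨hy.1.1, hy.2⟩
  have h2 := hK i y hy.1.1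
  have h3 : K * ‖y - x‖ < ε / 3 := hy.1.2
  rw [dist_eq_norm] at hi ⊢
  calc ‖g y - f i y‖ = ‖(g y - g x) - (f i x - g x) - (f i y - f i x)‖ := by congr 1; abel
    _ ≤ ‖g y - g x‖ + ‖f i x - g x‖ + ‖f i y - f i x‖ :=
        (norm_sub_le _ _).trans (by gcongr; exact norm_sub_le _ _)
    _ < ε := by linarith

variable [NormedSpace ℝ X] [NormedSpace ℝ V]

theorem ContDiffOn.differentiableAt_iteratedFDeriv {f : X → V} {s : Set X}
    (hf : ContDiffOn ℝ ∞ f s) (hs : IsOpen s) (m : ℕ) {x : X} (hx : x ∈ s) :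
    DifferentiableAt ℝ (iteratedFDeriv ℝ m f) x :=
  (hf.contDiffAt (hs.mem_nhds hx)).differentiableAt_iteratedFDeriv
    (by exact_mod_cast (ENat.natCast_lt_top m))

/-- A bound on the derivative of order `m + 1` on a convex open set makes the derivative of order
`m` Lipschitz. -/
theorem norm_iteratedFDeriv_sub_le {f : X → V} {s : Set X} (hf : ContDiffOn ℝ ∞ f s)
    (hs : IsOpen s) {t : Set X} (hts : t ⊆ s) (hconv : Convex ℝ t) {m : ℕ} {C : ℝ}
    (hC : ∀ y ∈ t, ‖iteratedFDeriv ℝ (m + 1) f y‖ ≤ C) {x y : X} (hx : x ∈ t) (hy : y ∈ t) :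
    ‖iteratedFDeriv ℝ m f y - iteratedFDeriv ℝ m f x‖ ≤ C * ‖y - x‖ :=
  hconv.norm_image_sub_le_of_norm_fderiv_le (𝕜 := ℝ)
    (fun z hz => hf.differentiableAt_iteratedFDeriv hs m (hts hz))
    (fun z hz => by rw [norm_fderiv_iteratedFDeriv]; exact hC z hz) hx hy

instance ContinuousMultilinearMap.finiteDimensional_fin [FiniteDimensional ℝ X]
    [FiniteDimensional ℝ V] (m : ℕ) : FiniteDimensional ℝ (X [×m]→L[ℝ] V) :=
  Module.Finite.of_injective (ContinuousMultilinearMap.toMultilinearMapLinear :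
      (X [×m]→L[ℝ] V) →ₗ[ℝ] MultilinearMap ℝ (fun _ : Fin m => X) V)
    ContinuousMultilinearMap.toMultilinearMap_injective

/-- A bounded family in a finite-dimensional space converges along every ultrafilter. -/
theorem exists_tendsto_ultrafilter_of_norm_le [FiniteDimensional ℝ V] {ι : Type*}
    (U : Ultrafilter ι) {f : ι → V} {C : ℝ} (hC : ∀ i, ‖f i‖ ≤ C) :
    ∃ v, Tendsto f U (𝓝 v) := by
  have := FiniteDimensional.proper_real V
  obtain ⟨v, -, hv⟩ := (isCompact_closedBall (0 : V) C).ultrafilter_le_nhds (U.map f) (by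
    rw [Ultrafilter.coe_map, le_principal_iff, mem_map]
    exact Eventually.of_forall fun i => by simpa using hC i)
  exact ⟨v, hv⟩

/-- A pointwise limit along an ultrafilter of smooth functions, all of whose derivatives are
bounded on a convex open set, is smooth, and all derivatives converge. -/
theorem contDiffOn_and_tendsto_iteratedFDeriv_of_ultrafilter [FiniteDimensional ℝ X]
    [FiniteDimensional ℝ V] {ι : Type*} (U : Ultrafilter ι) {s : Set X} (hs : IsOpen s)
    (hconv : Convex ℝ s) {w : ι → X → V} {w₀ : X → V} (hw : ∀ i, ContDiffOn ℝ ∞ (w i) s)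
    (hbdd : ∀ m : ℕ, ∃ C : ℝ, ∀ i, ∀ y ∈ s, ‖iteratedFDeriv ℝ m (w i) y‖ ≤ C)
    (hlim : ∀ y ∈ s, Tendsto (fun i => w i y) U (𝓝 (w₀ y))) :
    ContDiffOn ℝ ∞ w₀ s ∧ ∀ m : ℕ, ∀ y ∈ s,
      Tendsto (fun i => iteratedFDeriv ℝ m (w i) y) U (𝓝 (iteratedFDeriv ℝ m w₀ y)) := by
  choose C hC using hbdd
  have hex : ∀ (y : X) (m : ℕ), ∃ v : X [×m]→L[ℝ] V,
      y ∈ s → Tendsto (fun i => iteratedFDeriv ℝ m (w i) y) U (𝓝 v) := fun y m => by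
    by_cases hy : y ∈ s
    · obtain ⟨v, hv⟩ := exists_tendsto_ultrafilter_of_norm_le U (fun i => hC m i y hy)
      exact ⟨v, fun _ => hv⟩
    · exact ⟨0, fun h => absurd h hy⟩
  choose p hp using hex
  have hderiv : ∀ m : ℕ, ∀ y ∈ s,
      HasFDerivAt (fun z => p z m) (p y (m + 1)).curryLeft y := fun m => by
    refine fun y hy => hasFDerivAt_of_tendstoLocallyUniformlyOn (l := (U : Filter ι)) (s := s)
      (f := fun i => iteratedFDeriv ℝ m (w i))
      (f' := fun i => fderiv ℝ (iteratedFDeriv ℝ m (w i))) (g' := fun y => (p y (m + 1)).curryLeft)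
      hs ?_ ?_ (fun z hz => hp z m hz) hy
    -- Differentiating the limit needs locally uniform convergence of the first derivative of the
    -- `m`-th derivative. Up to the currying isometry this is the derivative of order `m + 1`, which
    -- is Lipschitz by the bound of order `m + 2`.
    · refine tendstoLocallyUniformlyOn_of_locally_lipschitz
        (fun x hx => ⟨s, hs.mem_nhds hx, C (m + 1 + 1), fun i y hy => ?_⟩) fun x hx => ?_
      · have h := norm_iteratedFDeriv_sub_le (hw i) hs subset_rfl hconv (hC (m + 1 + 1) i) hx hy
        rw [← dist_eq_norm] at h
        rw [← dist_eq_norm, fderiv_iteratedFDeriv, Function.comp_apply, Function.comp_apply]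
        exact ((continuousMultilinearCurryLeftEquiv ℝ (fun _ : Fin (m + 1) => X) V).dist_map
          _ _).trans_le h
      · simp_rw [fderiv_iteratedFDeriv, Function.comp_apply]
        exact ((continuousMultilinearCurryLeftEquiv ℝ (fun _ : Fin (m + 1) => X) V).continuous.tendsto
          _).comp (hp x (m + 1) hx)
    · exact fun i z hz => ((hw i).differentiableAt_iteratedFDeriv hs m hz).hasFDerivAt
  have hT : HasFTaylorSeriesUpToOn ∞ w₀ p s := by
    refine ⟨fun y hy => ?_, fun m _ y hy => (hderiv m y hy).hasFDerivWithinAt,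
      fun m _ y hy => (hderiv m y hy).continuousAt.continuousWithinAt⟩
    refine tendsto_nhds_unique (l := (U : Filter ι)) (f := fun i => w i y) ?_ (hlim y hy)
    exact ((continuousMultilinearCurryFin0 ℝ X V).continuous.tendsto _).comp (hp y 0 hy)
  have hsmooth : ContDiffOn ℝ ∞ w₀ s := hT.contDiffOn
  refine ⟨hsmooth, fun m y hy => ?_⟩
  rw [← iteratedFDerivWithin_of_isOpen m hs hy,
    ← hT.eq_iteratedFDerivWithin_of_uniqueDiffOn (by exact_mod_cast le_top) hs.uniqueDiffOn hy]
  exact hp y m hy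

/-- If evaluations are uniformly bounded on a Banach space of smooth functions, then so are all
derivatives. -/
theorem exists_norm_iteratedFDeriv_le_mul_norm [FiniteDimensional ℝ X] {N : Type*}
    [NormedAddCommGroup N] [NormedSpace ℝ N] [CompleteSpace N] (J : N →ₗ[ℝ] X → V) {y₀ : X}
    {r R : ℝ} (hrR : r < R) (hJ : ∀ f, ContDiffOn ℝ ∞ (J f) (Metric.ball y₀ R))
    (hbase : ∃ C : ℝ, ∀ f, ∀ y ∈ Metric.ball y₀ r, ‖J f y‖ ≤ C * ‖f‖) (m : ℕ) :
    ∃ C : ℝ, ∀ f, ∀ y ∈ Metric.ball y₀ r, ‖iteratedFDeriv ℝ m (J f) y‖ ≤ C * ‖f‖ := by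
  have := FiniteDimensional.proper_real X
  have hsub : Metric.ball y₀ r ⊆ Metric.ball y₀ R := Metric.ball_subset_ball hrR.le
  have hsub' : Metric.closedBall y₀ r ⊆ Metric.ball y₀ R := Metric.closedBall_subset_ball hrR
  induction m with
  | zero => simpa using hbase
  | succ m ih =>
    obtain ⟨C, hC⟩ := ih
    have hcd : ∀ f, ∀ y ∈ Metric.ball y₀ R, ContDiffAt ℝ m (J f) y := fun f y hy =>
      ((hJ f).contDiffAt (Metric.isOpen_ball.mem_nhds hy)).of_le (by exact_mod_cast le_top)
    -- The induction hypothesis is exactly the continuity of the evaluation of the `m`-th derivative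
    -- at `y`.
    have hlin : ∀ y : Metric.ball y₀ r, ∃ T : N →L[ℝ] X [×m]→L[ℝ] V,
        ∀ f, T f = iteratedFDeriv ℝ m (J f) y := fun y =>
      ⟨LinearMap.mkContinuous
        { toFun := fun f => iteratedFDeriv ℝ m (J f) y
          map_add' := fun f g => by
            rw [map_add]
            exact iteratedFDeriv_add_apply (hcd f y (hsub y.2)) (hcd g y (hsub y.2))
          map_smul' := fun c f => by
            rw [map_smul]
            exact iteratedFDeriv_const_smul_apply (hcd f y (hsub y.2)) }
        C (fun f => hC f y y.2), fun f => rfl⟩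
    choose T hT using hlin
    -- The family consists of all difference quotients of the `m`-th derivative; on the diagonal the
    -- quotient is `0`. For fixed `f` it is bounded by the mean value inequality, as the derivative
    -- of order `m + 1` is continuous on the compact closed ball of radius `r < R`.
    obtain ⟨D, hD⟩ := banach_steinhaus
      (g := fun p : Metric.ball y₀ r × Metric.ball y₀ r =>
        ‖(p.1 : X) - p.2‖⁻¹ • (T p.1 - T p.2)) (fun f => by
      have hcont : ContinuousOn (iteratedFDeriv ℝ (m + 1) (J f)) (Metric.closedBall y₀ r) :=
        fun y hy => ((hJ f).differentiableAt_iteratedFDeriv Metric.isOpen_ball _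
          (hsub' hy)).continuousAt.continuousWithinAt
      obtain ⟨B, hB⟩ := (isCompact_closedBall y₀ r).exists_bound_of_continuousOn hcont
      refine ⟨B, fun p => ?_⟩
      have hp := norm_iteratedFDeriv_sub_le (hJ f) Metric.isOpen_ball hsub (convex_ball y₀ r)
        (fun y hy => hB y (Metric.ball_subset_closedBall hy)) p.2.2 p.1.2
      have hB0 : 0 ≤ B := (norm_nonneg _).trans (hB p.1 (Metric.ball_subset_closedBall p.1.2))
      rw [smul_apply, sub_apply, hT, hT, norm_smul,
        norm_inv, norm_norm]
      exact inv_mul_le_of_le_mul₀ (norm_nonneg _) hB0 (by rwa [mul_comm]))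
    have hD0 : ∀ y ∈ Metric.ball y₀ r, 0 ≤ D := fun y hy =>
      (norm_nonneg _).trans (hD (⟨y, hy⟩, ⟨y, hy⟩))
    refine ⟨D, fun f y hy => ?_⟩
    rw [← norm_fderiv_iteratedFDeriv]
    -- The uniform bound on quotients is a Lipschitz bound near `y`, which controls the next
    -- derivative.
    refine norm_fderiv_le_of_lip' ℝ (mul_nonneg (hD0 y hy) (norm_nonneg _)) ?_
    filter_upwards [Metric.isOpen_ball.mem_nhds hy] with z hz
    have h1 := (ContinuousLinearMap.le_opNorm _ f).trans
      (mul_le_mul_of_nonneg_right (hD (⟨z, hz⟩, ⟨y, hy⟩)) (norm_nonneg f))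
    rw [smul_apply, sub_apply, hT, hT, norm_smul,
      norm_inv, norm_norm] at h1
    rcases eq_or_ne z y with rfl | hzy
    · simp
    · have hpos : 0 < ‖z - y‖ := norm_pos_iff.2 (sub_ne_zero.2 hzy)
      rw [mul_comm]
      exact (inv_mul_le_iff₀ hpos).1 h1

end LocalAnalysis

/-! ### Measures given by smooth positive densities -/

section SmoothDensity

variable {n : ℕ} {M : Type*} [TopologicalSpace M]
    [ChartedSpace (EuclideanSpace ℝ (Fin n)) M] [MeasurableSpace M] [BorelSpace M] {μ : Measure M}

/-- The density is continuous, hence bounded on a small coordinate ball, and such a ball has finite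
Lebesgue measure. -/
theorem IsSmoothPositiveDensity.isLocallyFiniteMeasure (hμ : IsSmoothPositiveDensity n μ) :
    IsLocallyFiniteMeasure μ := by
  refine ⟨fun x => ?_⟩
  obtain ⟨ρ, hρ, hpos, hint⟩ := hμ x
  set c := chartAt (EuclideanSpace ℝ (Fin n)) x
  have hx : x ∈ c.source := mem_chart_source _ x
  have hcont : ContinuousAt ρ (c x) :=
    hρ.continuousOn.continuousAt (c.open_target.mem_nhds (c.map_source hx))
  obtain ⟨ε, hε, hball⟩ := Metric.eventually_nhds_iff_ball.1
    (hcont.eventually_lt_const (lt_add_one (ρ (c x))))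
  have hopen : IsOpen (c.source ∩ c ⁻¹' Metric.ball (c x) ε) := c.isOpen_inter_preimage
    Metric.isOpen_ball
  refine ⟨_, hopen.mem_nhds ⟨hx, Metric.mem_ball_self hε⟩, ?_⟩
  rw [hint _ inter_subset_left hopen.measurableSet]
  calc ∫⁻ y in c '' (c.source ∩ c ⁻¹' Metric.ball (c x) ε), ENNReal.ofReal (ρ y)
      ≤ ∫⁻ y in Metric.ball (c x) ε, ENNReal.ofReal (ρ y) :=
        lintegral_mono_set (by rintro _ ⟨z, hz, rfl⟩; exact hz.2)
    _ ≤ ∫⁻ y in Metric.ball (c x) ε, ENNReal.ofReal (ρ (c x) + 1) :=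
        setLIntegral_mono' measurableSet_ball fun y hy => ENNReal.ofReal_le_ofReal (hball y hy).le
    _ < ⊤ := by
        rw [setLIntegral_const]
        exact ENNReal.mul_lt_top ENNReal.ofReal_lt_top measure_ball_lt_top

/-- Near a point the density exceeds half its positive value there, so a null neighbourhood would
force a Lebesgue-null ball. -/
theorem IsSmoothPositiveDensity.isOpenPosMeasure (hμ : IsSmoothPositiveDensity n μ) :
    μ.IsOpenPosMeasure := by
  refine ⟨fun U hU ⟨x, hxU⟩ h0 => ?_⟩
  obtain ⟨ρ, hρ, hpos, hint⟩ := hμ x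
  set c := chartAt (EuclideanSpace ℝ (Fin n)) x
  have hx : x ∈ c.source := mem_chart_source _ x
  have hcont : ContinuousAt ρ (c x) :=
    hρ.continuousOn.continuousAt (c.open_target.mem_nhds (c.map_source hx))
  have hρx := hpos _ (c.map_source hx)
  have hsU : IsOpen (c.source ∩ U) := c.open_source.inter hU
  have himg : c '' (c.source ∩ U) ∈ 𝓝 (c x) :=
    (c.isOpen_image_of_subset_source hsU inter_subset_left).mem_nhds ⟨x, ⟨hx, hxU⟩, rfl⟩
  obtain ⟨ε, hε, hball⟩ := Metric.eventually_nhds_iff_ball.1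
    ((hcont.eventually_const_lt (half_lt_self hρx)).and himg)
  have h1 := hint _ inter_subset_left hsU.measurableSet
  rw [measure_mono_null inter_subset_right h0] at h1
  have h2 : ∫⁻ y in Metric.ball (c x) ε, ENNReal.ofReal (ρ (c x) / 2) ≤ 0 :=
    calc ∫⁻ y in Metric.ball (c x) ε, ENNReal.ofReal (ρ (c x) / 2)
        ≤ ∫⁻ y in Metric.ball (c x) ε, ENNReal.ofReal (ρ y) :=
          setLIntegral_mono' measurableSet_ball fun y hy =>
            ENNReal.ofReal_le_ofReal (hball y hy).1.le
      _ ≤ ∫⁻ y in c '' (c.source ∩ U), ENNReal.ofReal (ρ y) :=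
          lintegral_mono_set fun y hy => (hball y hy).2
      _ = 0 := h1.symm
  rw [setLIntegral_const, nonpos_iff_eq_zero, mul_eq_zero, ENNReal.ofReal_eq_zero] at h2
  rcases h2 with h2 | h2
  · linarith
  · exact (Metric.measure_ball_pos volume (c x) hε).ne' h2

end SmoothDensity

/-! ### Integration and averaging of `L¹` functions -/

section Averages

variable {M : Type*} [TopologicalSpace M] [MeasurableSpace M] [BorelSpace M]
  {V : Type*} [NormedAddCommGroup V] [NormedSpace ℝ V]

/-- Integration of an `L¹` function against a bounded continuous family of functionals. -/
theorem integrable_clm_apply_and_norm_integral_le [SecondCountableTopology M]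
    [FiniteDimensional ℝ V] {μ : Measure M} {Ω : Set M} (hΩ : IsOpen Ω) {a : M → V →L[ℝ] ℝ}
    (ha : ContinuousOn a Ω) {B : ℝ} (hB : ∀ x ∈ Ω, ‖a x‖ ≤ B) (f : Lp V 1 (μ.restrict Ω)) :
    Integrable (fun x => a x (f x)) (μ.restrict Ω) ∧
      ‖∫ x in Ω, a x (f x) ∂μ‖ ≤ B * ‖f‖ := by
  have hf : Integrable f (μ.restrict Ω) := L1.integrable_coeFn f
  have hle : ∀ᵐ x ∂μ.restrict Ω, ‖a x (f x)‖ ≤ B * ‖f x‖ := by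
    filter_upwards [ae_restrict_mem hΩ.measurableSet] with x hx
    exact (a x).le_of_opNorm_le (hB x hx) _
  have hmeas : AEStronglyMeasurable (fun x => a x (f x)) (μ.restrict Ω) :=
    (ContinuousLinearMap.id ℝ (V →L[ℝ] ℝ)).aestronglyMeasurable_comp₂
      (ha.aestronglyMeasurable hΩ.measurableSet) hf.aestronglyMeasurable
  refine ⟨(hf.norm.const_mul B).mono' hmeas hle, ?_⟩
  rw [L1.norm_eq_integral_norm, ← integral_const_mul]
  exact norm_integral_le_of_norm_le (hf.norm.const_mul B) hle

/-- If the elements of a Banach space that maps continuously to `L¹(Ω)` are represented by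
continuous functions, then their supremum over relatively compact open sets is controlled by their
norm. -/
theorem exists_norm_le_mul_norm_of_continuousOn {μ : Measure M} [IsLocallyFiniteMeasure μ]
    [μ.IsOpenPosMeasure] [CompleteSpace V]
    {Ω : Set M} (hΩ : IsOpen Ω) {N : Type*} [NormedAddCommGroup N] [NormedSpace ℝ N]
    [CompleteSpace N] (i : N →L[ℝ] Lp V 1 (μ.restrict Ω)) (J : N → M → V)
    (hJ : ∀ f, ContinuousOn (J f) Ω) (hJi : ∀ f, J f =ᵐ[μ.restrict Ω] i f) {K U : Set M}
    (hK : IsCompact K) (hKΩ : K ⊆ Ω) (hU : IsOpen U) (hUK : U ⊆ K) :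
    ∃ C : ℝ, ∀ f, ∀ x ∈ U, ‖J f x‖ ≤ C * ‖f‖ := by
  have hfin : ∀ O ⊆ U, μ O ≠ ⊤ := fun O hO =>
    ((measure_mono (hO.trans hUK)).trans_lt hK.measure_lt_top).ne
  have hint : ∀ (f : N) (O : Set M), Integrable (i f) ((μ.restrict Ω).restrict O) := fun f O =>
    (L1.integrable_coeFn (i f)).restrict
  have hT : ∀ O : Set M, ∃ T : N →L[ℝ] V, ∀ f, T f = ⨍ x in O, i f x ∂(μ.restrict Ω) := fun O => by
    let S : Lp V 1 (μ.restrict Ω) →ₗ[ℝ] V :=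
      { toFun := fun f => ∫ x in O, f x ∂(μ.restrict Ω)
        map_add' := fun f g => by
          rw [← integral_add (L1.integrable_coeFn f).restrict (L1.integrable_coeFn g).restrict]
          exact integral_congr_ae (ae_restrict_of_ae (Lp.coeFn_add f g))
        map_smul' := fun c f => by
          rw [RingHom.id_apply, ← integral_smul]
          exact integral_congr_ae (ae_restrict_of_ae (Lp.coeFn_smul c f)) }
    have hS : ∀ f, ‖S f‖ ≤ 1 * ‖f‖ := fun f => by
      rw [one_mul, L1.norm_eq_integral_norm]
      exact (norm_integral_le_integral_norm _).trans
        (setIntegral_le_integral (L1.integrable_coeFn f).norm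
          (Eventually.of_forall fun x => norm_nonneg _))
    refine ⟨((μ.restrict Ω).real O)⁻¹ • (S.mkContinuous 1 hS).comp i, fun f => ?_⟩
    rw [setAverage_eq]
    rfl
  choose T hT using hT
  -- Averages stay in closed convex sets. This is used with a ball around `0`, to bound averages for
  -- fixed `f`, and with a small ball around `J f x`, to recover the value at `x`.
  have havg : ∀ (f : N) (O : Set M), IsOpen O → O.Nonempty → O ⊆ U → ∀ s : Set V, IsClosed s →
      Convex ℝ s → (∀ x ∈ O, J f x ∈ s) → T O f ∈ s := fun f O hO hne hOU s hs hconv hmem => by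
    have hOΩ : O ⊆ Ω := hOU.trans (hUK.trans hKΩ)
    have hmeas : (μ.restrict Ω) O = μ O := by
      rw [Measure.restrict_apply hO.measurableSet, inter_eq_left.2 hOΩ]
    rw [hT]
    refine hconv.set_average_mem hs (by rw [hmeas]; exact hO.measure_ne_zero μ hne)
      (by rw [hmeas]; exact hfin O hOU) ?_ (hint f O)
    filter_upwards [ae_restrict_of_ae (hJi f), ae_restrict_mem hO.measurableSet] with x hx hxO
    rw [← hx]
    exact hmem x hxO
  -- For fixed `f`, a bound of `J f` on the compact set `K` bounds all averages over open subsets of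
  -- `U`.
  obtain ⟨C, hC⟩ := banach_steinhaus (g := fun O : {O : Set M // IsOpen O ∧ O.Nonempty ∧ O ⊆ U} =>
    T O) (fun f => by
      obtain ⟨B, hB⟩ := hK.exists_bound_of_continuousOn ((hJ f).mono hKΩ)
      refine ⟨B, fun O => ?_⟩
      have := havg f O O.2.1 O.2.2.1 O.2.2.2 (Metric.closedBall 0 B) Metric.isClosed_closedBall
        (convex_closedBall 0 B) fun x hx => by simpa using hB x (hUK (O.2.2.2 hx))
      simpa using this)
  refine ⟨C, fun f x hx => le_of_forall_pos_le_add fun ε hε => ?_⟩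
  have hcont : ContinuousAt (J f) x := (hJ f).continuousAt (hΩ.mem_nhds (hKΩ (hUK hx)))
  obtain ⟨O, hOsub, hO, hxO⟩ := mem_nhds_iff.1
    (inter_mem (hcont (Metric.closedBall_mem_nhds (J f x) hε)) (hU.mem_nhds hx))
  have h1 := havg f O hO ⟨x, hxO⟩ (fun y hy => (hOsub hy).2) _ Metric.isClosed_closedBall
    (convex_closedBall (J f x) ε) fun y hy => (hOsub hy).1
  have h2 := (T O).le_of_opNorm_le (hC ⟨O, hO, ⟨x, hxO⟩, fun y hy => (hOsub hy).2⟩) f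
  rw [mem_closedBall_iff_norm'] at h1
  calc ‖J f x‖ = ‖T O f + (J f x - T O f)‖ := by congr 1; abel
    _ ≤ ‖T O f‖ + ‖J f x - T O f‖ := norm_add_le _ _
    _ ≤ C * ‖f‖ + ε := add_le_add h2 h1

end Averages

theorem eq_zero_of_notMem_secSupport {M : Type*} [TopologicalSpace M] {E : M → Type*}
    [∀ x, AddCommGroup (E x)] {s : ∀ x, E x} {x : M} (hx : x ∉ secSupport s) : s x = 0 :=
  by_contra fun h => hx (subset_closure h)

theorem isOpen_coordDomain {n : ℕ} {M : Type*} [TopologicalSpace M]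
    [ChartedSpace (EuclideanSpace ℝ (Fin n)) M] {V : Type*} [NormedAddCommGroup V]
    {E : M → Type*} [TopologicalSpace (TotalSpace V E)] [∀ x, TopologicalSpace (E x)]
    [∀ x, AddCommGroup (E x)] [FiberBundle V E] (x₀ : M) :
    IsOpen (coordDomain (n := n) V E x₀) :=
  (chartAt (EuclideanSpace ℝ (Fin n)) x₀).isOpen_inter_preimage_symm
    (trivializationAt V E x₀).open_baseSet

/-! ### Sections and the dual pairing in local trivializations -/

section SectionsInCoordinates

variable {n : ℕ} {M : Type*} [TopologicalSpace M] [ChartedSpace (EuclideanSpace ℝ (Fin n)) M]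
  {V : Type*} [NormedAddCommGroup V] [NormedSpace ℝ V]
  {E : M → Type*} [TopologicalSpace (TotalSpace V E)] [∀ x, AddCommGroup (E x)]
  [∀ x, Module ℝ (E x)] [∀ x, TopologicalSpace (E x)] [FiberBundle V E] [VectorBundle ℝ V E]

/-- The trivialization of `E^*` is induced by that of `E`, so the coordinate expression of the
pairing is plain evaluation. -/
theorem dualBundle_apply_eq (x₀ : M) {x : M} (hx : x ∈ (trivializationAt V E x₀).baseSet)
    (φ : DualBundle E x) (v : E x) :
    φ v = (trivializationAt (V →L[ℝ] ℝ) (DualBundle E) x₀ ⟨x, φ⟩).2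
      (trivializationAt V E x₀ ⟨x, v⟩).2 := by
  have h : ∀ w : V, (trivializationAt (V →L[ℝ] ℝ) (DualBundle E) x₀ ⟨x, φ⟩).2 w =
      φ ((trivializationAt V E x₀).symm x w) := fun w => by
    simp [hom_trivializationAt_apply, ContinuousLinearMap.inCoordinates, hx,
      Trivialization.symmL_apply]
  rw [h, Trivialization.symm_apply_apply_mk _ hx]

variable [ContMDiffVectorBundle ∞ V E (𝓡 n)]

/-- The coordinates of a smooth section in a trivialization are smooth. -/
theorem contMDiffOn_trivializationAt_snd (s : SmoothSec (n := n) V E) (x₀ : M) :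
    ContMDiffOn (𝓡 n) 𝓘(ℝ, V) ∞ (fun x => (trivializationAt V E x₀ ⟨x, s x⟩).2)
      (trivializationAt V E x₀).baseSet :=
  (Trivialization.contMDiffOn_section_baseSet_iff _).1 s.contMDiff.contMDiffOn

theorem contDiffOn_comp_chartAt_symm [IsManifold (𝓡 n) ∞ M] {G : Type*} [NormedAddCommGroup G]
    [NormedSpace ℝ G] (x₀ : M) {w : M → G} {s : Set M} (hw : ContMDiffOn (𝓡 n) 𝓘(ℝ, G) ∞ w s) :
    ContDiffOn ℝ ∞ (w ∘ (chartAt (EuclideanSpace ℝ (Fin n)) x₀).symm)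
      ((chartAt (EuclideanSpace ℝ (Fin n)) x₀).target ∩
        (chartAt (EuclideanSpace ℝ (Fin n)) x₀).symm ⁻¹' s) := by
  rw [← contMDiffOn_iff_contDiffOn]
  exact hw.comp ((contMDiffOn_chart_symm (I := 𝓡 n)).mono inter_subset_left) inter_subset_right

theorem contDiffOn_coordRep [IsManifold (𝓡 n) ∞ M] (s : SmoothSec (n := n) V E) (x₀ : M) :
    ContDiffOn ℝ ∞ (coordRep (n := n) V x₀ s) (coordDomain (n := n) V E x₀) :=
  contDiffOn_comp_chartAt_symm x₀ (contMDiffOn_trivializationAt_snd s x₀)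

/-- A functional on the model fibre, multiplied by a bump function supported in the domain of a
trivialization, gives a test section of the dual bundle. -/
theorem exists_testSec_apply_eq [IsManifold (𝓡 n) ∞ M] (x₀ : M) {Ω : Set M}
    (hΩ : Ω ⊆ (trivializationAt V E x₀).baseSet)
    {ψ : M → ℝ} (hψ : ContMDiff (𝓡 n) 𝓘(ℝ, ℝ) ∞ ψ) (hc : HasCompactSupport ψ)
    (hsupp : tsupport ψ ⊆ Ω) (l : V →L[ℝ] ℝ) :
    ∃ φ : TestSec (n := n) (V →L[ℝ] ℝ) (DualBundle E) Ω, ∀ x (v : E x),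
      φ.1 x v = ψ x * l (trivializationAt V E x₀ ⟨x, v⟩).2 := by
  set e := trivializationAt V E x₀
  -- This section has constant coordinate `l` over the base set; cutting off by `ψ` makes it
  -- globally smooth.
  let s : ∀ x, DualBundle E x := fun x => l.comp (e.continuousLinearMapAt ℝ x)
  have hs : ContMDiffOn (𝓡 n) ((𝓡 n).prod 𝓘(ℝ, V →L[ℝ] ℝ)) ∞
      (fun x => TotalSpace.mk' (V →L[ℝ] ℝ) x (s x)) e.baseSet := by
    have hsub : e.baseSet ⊆
        (trivializationAt (V →L[ℝ] ℝ) (DualBundle E) x₀).baseSet := fun x hx => ⟨hx, mem_univ _⟩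
    rw [Trivialization.contMDiffOn_section_iff _ e.open_baseSet hsub]
    refine (contMDiffOn_const (c := l)).congr fun x hx => ?_
    ext v
    rw [← (e.continuousLinearEquivAt ℝ x hx).apply_symm_apply v,
      Trivialization.continuousLinearEquivAt_apply, ← dualBundle_apply_eq x₀ hx]
    simp [s, e.coe_linearMapAt_of_mem hx]
  have hsm := ContMDiffOn.smul_section_of_tsupport (hψ.contMDiffOn (s := e.baseSet))
    e.open_baseSet (hsupp.trans hΩ) hs
  have hzero : ∀ x, x ∉ tsupport ψ → (ψ • s) x = 0 := fun x hx => by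
    change ψ x • s x = 0
    rw [image_eq_zero_of_notMem_tsupport hx, zero_smul]
  have hss : secSupport (ψ • s) ⊆ tsupport ψ :=
    closure_minimal (fun x hx => by_contra fun h => hx (hzero x h)) (isClosed_tsupport ψ)
  refine ⟨⟨⟨ψ • s, hsm⟩, hc.isCompact.of_isClosed_subset isClosed_closure hss, hss.trans hsupp⟩,
    fun x v => ?_⟩
  by_cases hx : x ∈ e.baseSet
  · change (ψ x • s x) v = _
    simp [s, e.coe_linearMapAt_of_mem hx]
  · have h0 : ψ x = 0 := image_eq_zero_of_notMem_tsupport fun h => hx (hΩ (hsupp h))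
    change (ψ x • s x) v = _
    rw [h0]
    simp

end SectionsInCoordinates

/-! ### Integrable functions as distributional sections -/

section DistributionalSolutions

variable {n : ℕ} {M : Type*} [TopologicalSpace M] [ChartedSpace (EuclideanSpace ℝ (Fin n)) M]
  {V : Type*} [NormedAddCommGroup V] [NormedSpace ℝ V]
  {E : M → Type*} [TopologicalSpace (TotalSpace V E)] [∀ x, AddCommGroup (E x)]
  [∀ x, Module ℝ (E x)] [∀ x, TopologicalSpace (E x)] [FiberBundle V E] [VectorBundle ℝ V E]
  [ContMDiffVectorBundle ∞ V E (𝓡 n)]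

theorem continuousOn_dualBundle_coord (φ : SmoothSec (n := n) (V →L[ℝ] ℝ) (DualBundle E)) (x₀ : M) :
    ContinuousOn (fun x => (trivializationAt (V →L[ℝ] ℝ) (DualBundle E) x₀ ⟨x, φ x⟩).2)
      (trivializationAt V E x₀).baseSet :=
  (contMDiffOn_trivializationAt_snd φ x₀).continuousOn.mono fun _ hx => ⟨hx, mem_univ _⟩

variable [FiniteDimensional ℝ V] [SecondCountableTopology M] [MeasurableSpace M] [BorelSpace M] {μ : Measure M}
  {x₀ : M} {Ω K : Set M}

/-- An integrable function on a relatively compact subset of a coordinate neighbourhood, seen as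
the coordinates of a section of `E`, defines a distributional section of `E`, which depends
continuously on the function. -/
theorem exists_distribSec_eq_integral (hΩ : IsOpen Ω) (hK : IsCompact K) (hΩK : Ω ⊆ K)
    (hKe : K ⊆ (trivializationAt V E x₀).baseSet)
    (hKc : K ⊆ (chartAt (EuclideanSpace ℝ (Fin n)) x₀).source) :
    ∃ T : Lp V 1 (μ.restrict Ω) → DistribSec (n := n) V E Ω,
      (∀ f φ, (T f).toLin φ = ∫ x in Ω,
        (trivializationAt (V →L[ℝ] ℝ) (DualBundle E) x₀ ⟨x, φ.1 x⟩).2 (f x) ∂μ) ∧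
      ∀ φ, ∃ P : Lp V 1 (μ.restrict Ω) →L[ℝ] ℝ, ∀ f, P f = (T f).toLin φ := by
  set e' := trivializationAt (V →L[ℝ] ℝ) (DualBundle E) x₀
  have hlin : ∀ x ∈ Ω, e'.baseSet x := fun x hx => ⟨hKe (hΩK hx), mem_univ _⟩
  have hadd : ∀ x ∈ Ω, ∀ φ ψ : DualBundle E x,
      (e' ⟨x, φ + ψ⟩).2 = (e' ⟨x, φ⟩).2 + (e' ⟨x, ψ⟩).2 := fun x hx φ ψ =>
    (Trivialization.linear ℝ e' (hlin x hx)).map_add φ ψ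
  have hsmul : ∀ x ∈ Ω, ∀ (r : ℝ) (φ : DualBundle E x),
      (e' ⟨x, r • φ⟩).2 = r • (e' ⟨x, φ⟩).2 := fun x hx r φ =>
    (Trivialization.linear ℝ e' (hlin x hx)).map_smul r φ
  have hcont : ∀ φ : SmoothSec (n := n) (V →L[ℝ] ℝ) (DualBundle E),
      ContinuousOn (fun x => (e' ⟨x, φ x⟩).2) K := fun φ =>
    (continuousOn_dualBundle_coord φ x₀).mono hKe
  have hint : ∀ (φ : SmoothSec (n := n) (V →L[ℝ] ℝ) (DualBundle E)) (f : Lp V 1 (μ.restrict Ω)),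
      Integrable (fun x => (e' ⟨x, φ x⟩).2 (f x)) (μ.restrict Ω) := fun φ f => by
    obtain ⟨B, hB⟩ := hK.exists_bound_of_continuousOn (hcont φ)
    exact (integrable_clm_apply_and_norm_integral_le hΩ ((hcont φ).mono hΩK)
      (fun x hx => hB x (hΩK hx)) f).1
  let T₀ : Lp V 1 (μ.restrict Ω) →
      TestSec (n := n) (V →L[ℝ] ℝ) (DualBundle E) Ω →ₗ[ℝ] ℝ := fun f =>
    { toFun := fun φ => ∫ x in Ω, (e' ⟨x, φ.1 x⟩).2 (f x) ∂μ
      map_add' := fun φ ψ => by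
        rw [← integral_add (hint φ.1 f) (hint ψ.1 f)]
        refine setIntegral_congr_fun hΩ.measurableSet fun x hx => ?_
        change (e' ⟨x, φ.1 x + ψ.1 x⟩).2 (f x) = _
        rw [hadd x hx]
        rfl
      map_smul' := fun r φ => by
        rw [RingHom.id_apply, ← integral_smul]
        refine setIntegral_congr_fun hΩ.measurableSet fun x hx => ?_
        change (e' ⟨x, r • φ.1 x⟩).2 (f x) = _
        rw [hsmul x hx]
        rfl }
  have hT₀ : ∀ f φ, T₀ f φ = ∫ x in Ω, (e' ⟨x, φ.1 x⟩).2 (f x) ∂μ := fun f φ => rfl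
  refine ⟨fun f => ⟨T₀ f, fun φ φ₀ K' _ _ _ hφ => ?_⟩, fun f φ => rfl, fun φ => ?_⟩
  · set c := chartAt (EuclideanSpace ℝ (Fin n)) x₀
    have hcK : IsCompact (c '' K) := hK.image_of_continuousOn (c.continuousOn.mono hKc)
    have hsub : c '' K ⊆ coordDomain (n := n) (V →L[ℝ] ℝ) (DualBundle E) x₀ := by
      rintro _ ⟨x, hx, rfl⟩
      refine ⟨c.map_source (hKc hx), ?_⟩
      rw [mem_preimage, c.left_inv (hKc hx)]
      exact ⟨hKe hx, mem_univ _⟩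
    -- Against an `L¹` function, uniform convergence of the coordinates on `K` suffices, so only
    -- derivatives of order `0` enter.
    have hunif := (tendstoLocallyUniformlyOn_iff_tendstoUniformlyOn_of_compact hcK).1
      ((hφ x₀ 0).mono hsub)
    rw [Metric.tendstoUniformlyOn_iff] at hunif
    rw [Metric.tendsto_nhds]
    intro ε hε
    have hden : 0 < ‖f‖ + 1 := by positivity
    filter_upwards [hunif (ε / (‖f‖ + 1)) (by positivity)] with j hj
    have hB : ∀ x ∈ Ω, ‖(e' ⟨x, (φ j).1 x⟩).2 - (e' ⟨x, φ₀.1 x⟩).2‖ ≤ ε / (‖f‖ + 1) := by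
      intro x hx
      have h := hj (c x) ⟨x, hΩK hx, rfl⟩
      rw [iteratedFDeriv_zero_eq_comp, iteratedFDeriv_zero_eq_comp, Function.comp_apply,
        Function.comp_apply, LinearIsometryEquiv.dist_map, dist_comm, dist_eq_norm] at h
      have hcx : c.symm (c x) = x := c.left_inv (hKc (hΩK hx))
      simp only [coordRep] at h
      change ‖(e' ⟨c.symm (c x), (φ j).1 (c.symm (c x))⟩).2
        - (e' ⟨c.symm (c x), φ₀.1 (c.symm (c x))⟩).2‖ < _ at h
      rw [hcx] at h
      exact h.le
    have key := (integrable_clm_apply_and_norm_integral_le hΩ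
      (((hcont (φ j).1).mono hΩK).sub ((hcont φ₀.1).mono hΩK)) hB f).2
    rw [dist_eq_norm, hT₀, hT₀, ← integral_sub (hint _ f) (hint _ f)]
    refine lt_of_le_of_lt key ?_
    rw [div_mul_eq_mul_div, div_lt_iff₀ hden]
    nlinarith
  · obtain ⟨B, hB⟩ := hK.exists_bound_of_continuousOn (hcont φ.1)
    refine ⟨LinearMap.mkContinuous
      { toFun := fun f => T₀ f φ
        map_add' := fun f g => ?_
        map_smul' := fun r f => ?_ } B fun f => ?_, fun f => rfl⟩
    · rw [hT₀, hT₀, hT₀, ← integral_add (hint φ.1 f) (hint φ.1 g)]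
      refine integral_congr_ae ?_
      filter_upwards [Lp.coeFn_add f g] with x hx
      rw [hx, Pi.add_apply, map_add]
    · rw [hT₀, hT₀, RingHom.id_apply, ← integral_smul]
      refine integral_congr_ae ?_
      filter_upwards [Lp.coeFn_smul r f] with x hx
      rw [hx, Pi.smul_apply, map_smul]
    · exact (integrable_clm_apply_and_norm_integral_le hΩ ((hcont φ.1).mono hΩK)
        (fun x hx => hB x (hΩK hx)) f).2

variable [IsManifold (𝓡 n) ∞ M]

/-- If the distribution defined by an integrable function is smooth, then the function is almost
everywhere equal to a smooth function. -/
theorem exists_contMDiffOn_ae_eq_of_isSmooth [T2Space M] [IsLocallyFiniteMeasure μ]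
    (hΩ : IsOpen Ω) (hΩe : Ω ⊆ (trivializationAt V E x₀).baseSet) (f : Lp V 1 (μ.restrict Ω))
    {T : DistribSec (n := n) V E Ω}
    (hT : ∀ φ, T.toLin φ = ∫ x in Ω,
      (trivializationAt (V →L[ℝ] ℝ) (DualBundle E) x₀ ⟨x, φ.1 x⟩).2 (f x) ∂μ)
    (hsm : T.IsSmooth μ) :
    ∃ w : M → V, ContMDiffOn (𝓡 n) 𝓘(ℝ, V) ∞ w Ω ∧ w =ᵐ[μ.restrict Ω] f := by
  obtain ⟨s, hs, hTs⟩ := hsm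
  set e := trivializationAt V E x₀
  have hw : ContMDiffOn (𝓡 n) 𝓘(ℝ, V) ∞ (fun x => (e ⟨x, s x⟩).2) Ω :=
    (e.contMDiffOn_section_iff hΩ hΩe).1 hs
  have := FiniteDimensional.complete ℝ V
  have : LocallyCompactSpace M := ChartedSpace.locallyCompactSpace (EuclideanSpace ℝ (Fin n)) M
  have hfi : IntegrableOn f Ω μ := L1.integrable_coeFn f
  have hwl : LocallyIntegrableOn (fun x => (e ⟨x, s x⟩).2) Ω μ :=
    hw.continuousOn.locallyIntegrableOn hΩ.measurableSet
  refine ⟨_, hw, ?_⟩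
  have hzero : ∀ᵐ x ∂μ, x ∈ Ω → f x - (e ⟨x, s x⟩).2 = 0 := by
    -- The fundamental lemma of the calculus of variations; vector-valued integrals are compared
    -- through functionals `l`, each realised with `ψ` as a test section.
    refine hΩ.ae_eq_zero_of_integral_contMDiff_smul_eq_zero (𝓡 n)
      (hfi.locallyIntegrableOn.sub hwl) fun ψ hψ hc hsupp => ?_
    have hψf : Integrable (fun x => ψ x • f x) (μ.restrict Ω) := by
      obtain ⟨B, hB⟩ := hc.exists_bound_of_continuous hψ.continuous
      exact hfi.bdd_smul B hψ.continuous.aestronglyMeasurable (Eventually.of_forall hB)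
    have hψw : Integrable (fun x => ψ x • (e ⟨x, s x⟩).2) (μ.restrict Ω) := by
      have h1 : IntegrableOn (fun x => ψ x • (e ⟨x, s x⟩).2) (tsupport ψ) μ :=
        ((hψ.continuous.continuousOn).smul
          (hw.continuousOn.mono hsupp)).integrableOn_compact hc.isCompact
      exact (h1.integrable_of_forall_notMem_eq_zero fun x hx => by
        rw [image_eq_zero_of_notMem_tsupport hx, zero_smul]).restrict
    rw [← setIntegral_eq_integral_of_forall_compl_eq_zero (s := Ω) fun x hx => by
      rw [image_eq_zero_of_notMem_tsupport fun h => hx (hsupp h), zero_smul]]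
    simp_rw [smul_sub]
    rw [integral_sub hψf hψw, sub_eq_zero, SeparatingDual.eq_iff_forall_dual_eq (R := ℝ)]
    intro l
    obtain ⟨φ, hφ⟩ := exists_testSec_apply_eq x₀ hΩe hψ hc hsupp l
    rw [← l.integral_comp_comm hψf, ← l.integral_comp_comm hψw]
    calc ∫ x in Ω, l (ψ x • f x) ∂μ
        = ∫ x in Ω, (trivializationAt (V →L[ℝ] ℝ) (DualBundle E) x₀ ⟨x, φ.1 x⟩).2 (f x) ∂μ := by
          refine setIntegral_congr_fun hΩ.measurableSet fun x hx => ?_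
          -- The vector inserted is the one whose coordinate is `f x`.
          have h := hφ x (e.symm x (f x))
          rw [dualBundle_apply_eq x₀ (hΩe hx)] at h
          rw [show trivializationAt V E x₀ ⟨x, e.symm x (f x)⟩ = (x, f x) from
            e.apply_mk_symm (hΩe hx) _] at h
          simp only [map_smul, smul_eq_mul]
          exact h.symm
      _ = ∫ x, φ.1 x (s x) ∂μ := by rw [← hT, hTs]
      _ = ∫ x in Ω, l (ψ x • (e ⟨x, s x⟩).2) ∂μ := by
          simp_rw [hφ, map_smul, smul_eq_mul]
          exact (setIntegral_eq_integral_of_forall_compl_eq_zero fun x hx => by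
            rw [image_eq_zero_of_notMem_tsupport fun h => hx (hsupp h), zero_mul]).symm
  rw [Filter.EventuallyEq, ae_restrict_iff' hΩ.measurableSet]
  filter_upwards [hzero] with x hx hxΩ
  exact (sub_eq_zero.1 (hx hxΩ)).symm

end DistributionalSolutions

/-! ### Riemannian norm and coordinate norm -/

section RiemannianNorm

variable {n : ℕ} {M : Type*} [TopologicalSpace M] [ChartedSpace (EuclideanSpace ℝ (Fin n)) M]
  {V : Type*} [NormedAddCommGroup V] [NormedSpace ℝ V]
  {E : M → Type*} [TopologicalSpace (TotalSpace V E)] [∀ x, AddCommGroup (E x)]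
  [∀ x, Module ℝ (E x)] [∀ x, TopologicalSpace (E x)]
  [∀ x, IsTopologicalAddGroup (E x)] [∀ x, ContinuousConstSMul ℝ (E x)]
  [FiberBundle V E] [VectorBundle ℝ V E]

/-- Locally, the norm of the coordinates of a vector is controlled by its Riemannian norm. -/
theorem exists_norm_trivializationAt_le [ContMDiffVectorBundle ∞ V E (𝓡 n)]
    (g : ContMDiffRiemannianMetric (𝓡 n) ∞ V E) (x₀ : M)
    {x₁ : M} (hx₁ : x₁ ∈ (trivializationAt V E x₀).baseSet) :
    ∃ C > 0, ∀ᶠ x in 𝓝 x₁, ∀ v : E x,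
      ‖(trivializationAt V E x₀ ⟨x, v⟩).2‖ ≤ C * √(g.inner x v v) := by
  let : RiemannianBundle E := ⟨g.toRiemannianMetric⟩
  have : IsContinuousRiemannianBundle V E := ⟨g.inner, g.contMDiff.continuous, fun _ _ _ => rfl⟩
  set e := trivializationAt V E x₀
  set e₁ := trivializationAt V E x₁
  -- This bound concerns the trivialization centred at `x₁`; the coordinate change to the one
  -- centred at `x₀` is continuous, so locally it costs only the factor `D`.
  obtain ⟨C, hC, hle⟩ := eventually_norm_trivializationAt_lt V E x₁
  have hx₁' : x₁ ∈ e₁.baseSet := FiberBundle.mem_baseSet_trivializationAt' x₁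
  have hcc : ContinuousAt (fun x => (e₁.coordChangeL ℝ e x : V →L[ℝ] V)) x₁ :=
    (continuousOn_coordChange ℝ e₁ e).continuousAt
      ((e₁.open_baseSet.inter e.open_baseSet).mem_nhds ⟨hx₁', hx₁⟩)
  have hD := hcc.norm.eventually_lt_const (lt_add_one _)
  set D := ‖(e₁.coordChangeL ℝ e x₁ : V →L[ℝ] V)‖ + 1
  have hD0 : 0 < D := by positivity
  refine ⟨D * C, by positivity, ?_⟩
  filter_upwards [hle, hD, e₁.open_baseSet.mem_nhds hx₁', e.open_baseSet.mem_nhds hx₁]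
    with x h1 h2 h3 h4 v
  have hv : ‖v‖ = √(g.inner x v v) := by
    rw [norm_eq_sqrt_real_inner]
    rfl
  have hco : (e ⟨x, v⟩).2 = e₁.coordChangeL ℝ e x (e₁.continuousLinearMapAt ℝ x v) := by
    rw [e₁.coordChangeL_apply e ⟨h3, h4⟩, Trivialization.continuousLinearMapAt_apply,
      e₁.coe_linearMapAt_of_mem h3, e₁.symm_apply_apply_mk h3]
  rw [hco, ← hv, mul_assoc]
  refine ((e₁.coordChangeL ℝ e x : V →L[ℝ] V).le_of_opNorm_le h2.le _).trans ?_
  gcongr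
  exact (e₁.continuousLinearMapAt ℝ x).le_of_opNorm_le h1.le _

end RiemannianNorm

/-- A solution of `L u = 0` is a solution in the sense of distributions. -/
theorem integral_formalDualTest_apply_eq_zero {n : ℕ} {M : Type*} [TopologicalSpace M]
    [ChartedSpace (EuclideanSpace ℝ (Fin n)) M] [MeasurableSpace M] (μ : Measure M)
    {V : Type*} [NormedAddCommGroup V] [NormedSpace ℝ V]
    {E : M → Type*} [TopologicalSpace (TotalSpace V E)] [∀ x, AddCommGroup (E x)]
    [∀ x, Module ℝ (E x)] [∀ x, TopologicalSpace (E x)]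
    [FiberBundle V E] [VectorBundle ℝ V E]
    {W : Type*} [NormedAddCommGroup W] [NormedSpace ℝ W]
    {F : M → Type*} [TopologicalSpace (TotalSpace W F)] [∀ x, AddCommGroup (F x)]
    [∀ x, Module ℝ (F x)] [∀ x, TopologicalSpace (F x)]
    [FiberBundle W F] [VectorBundle ℝ W F]
    {L : SmoothSec (n := n) V E →ₗ[ℝ] SmoothSec (n := n) W F} {u : SmoothSec (n := n) V E}
    (hu : u ∈ solutionSpace L) {Ω : Set M} (φ : TestSec (n := n) (W →L[ℝ] ℝ) (DualBundle F) Ω) :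
    ∫ x, (formalDualTest μ L Ω φ).1 x (u x) ∂μ = 0 := by
  change ∫ x, (formalDual μ L φ.1) x (u x) ∂μ = 0
  by_cases h : ∃ L', IsFormalDual μ L L'
  · rw [← (formalDual_spec h).2 u φ.1
      (φ.2.1.of_isClosed_subset (isClosed_closure.inter isClosed_closure) inter_subset_right)]
    have h0 : L u = 0 := hu
    rw [h0]
    simp
  -- Here `formalDual` takes its default value `0`.
  · rw [formalDual, dif_neg h]
    simp

/-! ### Interior estimates from weak hypoellipticity -/

section LocalEstimates

variable {n : ℕ} {M : Type*} [TopologicalSpace M] [T2Space M]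
    [SecondCountableTopology M] [ChartedSpace (EuclideanSpace ℝ (Fin n)) M] [IsManifold (𝓡 n) ∞ M]
    [MeasurableSpace M] [BorelSpace M] {μ : Measure M}
    {V : Type*} [NormedAddCommGroup V] [NormedSpace ℝ V] [FiniteDimensional ℝ V]
    {E : M → Type*} [TopologicalSpace (TotalSpace V E)] [∀ x, AddCommGroup (E x)]
    [∀ x, Module ℝ (E x)] [∀ x, TopologicalSpace (E x)]
    [FiberBundle V E] [VectorBundle ℝ V E] [ContMDiffVectorBundle ∞ V E (𝓡 n)]
    {W : Type*} [NormedAddCommGroup W] [NormedSpace ℝ W]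
    {F : M → Type*} [TopologicalSpace (TotalSpace W F)] [∀ x, AddCommGroup (F x)]
    [∀ x, Module ℝ (F x)] [∀ x, TopologicalSpace (F x)]
    [FiberBundle W F] [VectorBundle ℝ W F]

/-- The interior estimate for solutions of a weakly hypoelliptic equation: all derivatives of a
solution are locally bounded in terms of its `L¹` norm. -/
theorem WeaklyHypoelliptic.exists_norm_iteratedFDeriv_coordRep_le
    [IsLocallyFiniteMeasure μ] [μ.IsOpenPosMeasure]
    {L : SmoothSec (n := n) V E →ₗ[ℝ] SmoothSec (n := n) W F} (hWH : WeaklyHypoelliptic μ L)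
    (x₀ : M) {y₀ : EuclideanSpace ℝ (Fin n)} {r R : ℝ} (hrR : r < R)
    (hR : Metric.closedBall y₀ R ⊆ coordDomain (n := n) V E x₀) (m : ℕ) :
    ∃ C : ℝ, ∀ u ∈ solutionSpace L, ∀ y ∈ Metric.ball y₀ r,
      ‖iteratedFDeriv ℝ m (coordRep V x₀ u) y‖ ≤
        C * ∫ x in (chartAt (EuclideanSpace ℝ (Fin n)) x₀).symm '' Metric.ball y₀ R,
          ‖(trivializationAt V E x₀ ⟨x, u x⟩).2‖ ∂μ := by
  have := FiniteDimensional.complete ℝ V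
  set c := chartAt (EuclideanSpace ℝ (Fin n)) x₀
  set e := trivializationAt V E x₀
  set Ω := c.symm '' Metric.ball y₀ R
  set K := c.symm '' Metric.closedBall y₀ R
  have hRt : Metric.closedBall y₀ R ⊆ c.target := fun y hy => (hR hy).1
  have hΩ : IsOpen Ω := c.isOpen_image_symm_of_subset_target Metric.isOpen_ball
    (Metric.ball_subset_closedBall.trans hRt)
  have hK : IsCompact K := (isCompact_closedBall y₀ R).image_of_continuousOn
    (c.continuousOn_symm.mono hRt)
  have hΩK : Ω ⊆ K := image_mono Metric.ball_subset_closedBall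
  have hKe : K ⊆ e.baseSet := by
    rintro _ ⟨y, hy, rfl⟩
    exact (hR hy).2
  have hKc : K ⊆ c.source := by
    rintro _ ⟨y, hy, rfl⟩
    exact c.map_target (hRt hy)
  have hΩe := hΩK.trans hKe
  have hball : Metric.ball y₀ R ⊆ c.target ∩ c.symm ⁻¹' Ω := fun y hy =>
    ⟨hRt (Metric.ball_subset_closedBall hy), y, hy, rfl⟩
  obtain ⟨T, hT, hTP⟩ := exists_distribSec_eq_integral (n := n) (V := V) (E := E) (μ := μ) hΩ hK
    hΩK hKe hKc
  choose P hP using hTP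
  -- the closed subspace of `L¹` of distributional solutions
  let N : Submodule ℝ (Lp V 1 (μ.restrict Ω)) :=
    ⨅ φ : TestSec (n := n) (W →L[ℝ] ℝ) (DualBundle F) Ω,
      LinearMap.ker (P (formalDualTest μ L Ω φ)).toLinearMap
  have hN : ∀ f, f ∈ N ↔ ∀ φ, (T f).toLin (formalDualTest μ L Ω φ) = 0 := fun f => by
    simp only [N, Submodule.mem_iInf, LinearMap.mem_ker, ContinuousLinearMap.coe_coe, hP]
  have hNclosed : IsClosed (N : Set (Lp V 1 (μ.restrict Ω))) := by
    rw [Submodule.coe_iInf]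
    exact isClosed_iInter fun φ => (P (formalDualTest μ L Ω φ)).isClosed_ker
  have : CompleteSpace N := hNclosed.completeSpace_coe
  -- The smooth representative is set to zero off `Ω`. On `Ω` it is unique because `μ` charges open
  -- sets, so the choice `J` is linear.
  have hreg : ∀ f : N, ∃ w : M → V, (ContMDiffOn (𝓡 n) 𝓘(ℝ, V) ∞ w Ω ∧ w =ᵐ[μ.restrict Ω] f) ∧
      ∀ x ∉ Ω, w x = 0 := fun f => by
    obtain ⟨w, hw, hwf⟩ := exists_contMDiffOn_ae_eq_of_isSmooth hΩ hΩe f.1 (hT f.1)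
      (hWH Ω hΩ (T f.1) (LinearMap.ext ((hN f.1).1 f.2)))
    refine ⟨Ω.indicator w, ⟨hw.congr fun x hx => indicator_of_mem hx w, ?_⟩,
      fun x hx => indicator_of_notMem hx w⟩
    exact (indicator_ae_eq_restrict hΩ.measurableSet).trans hwf
  choose J hJ hJ0 using hreg
  have huniq : ∀ {w w' : M → V}, ContinuousOn w Ω → ContinuousOn w' Ω →
      w =ᵐ[μ.restrict Ω] w' → EqOn w w' Ω := fun hw hw' h =>
    Measure.eqOn_open_of_ae_eq h hΩ hw hw'
  have hJc : ∀ f, ContinuousOn (J f) Ω := fun f => (hJ f).1.continuousOn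
  have hJadd : ∀ f g, J (f + g) = J f + J g := fun f g => by
    funext x
    by_cases hx : x ∈ Ω
    · refine huniq (hJc _) ((hJc f).add (hJc g)) ?_ hx
      filter_upwards [(hJ (f + g)).2, (hJ f).2, (hJ g).2, Lp.coeFn_add f.1 g.1] with x h1 h2 h3 h4
      rw [h1, Submodule.coe_add, h4, Pi.add_apply, Pi.add_apply, h2, h3]
    · simp [hJ0 _ x hx]
  have hJsmul : ∀ (t : ℝ) f, J (t • f) = t • J f := fun t f => by
    funext x
    by_cases hx : x ∈ Ω
    · refine huniq (hJc _) ((hJc f).const_smul t) ?_ hx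
      filter_upwards [(hJ (t • f)).2, (hJ f).2, Lp.coeFn_smul t f.1] with x h1 h2 h3
      rw [h1, Submodule.coe_smul, h3, Pi.smul_apply, Pi.smul_apply, h2]
    · simp [hJ0 _ x hx]
  let J' : N →ₗ[ℝ] EuclideanSpace ℝ (Fin n) → V :=
    { toFun := fun f => J f ∘ c.symm
      map_add' := fun f g => by rw [hJadd]; rfl
      map_smul' := fun t f => by rw [hJsmul]; rfl }
  have hJ' : ∀ f, ContDiffOn ℝ ∞ (J' f) (Metric.ball y₀ R) := fun f =>
    (contDiffOn_comp_chartAt_symm x₀ (hJ f).1).mono hball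
  have hbase : ∃ C : ℝ, ∀ f, ∀ y ∈ Metric.ball y₀ r, ‖J' f y‖ ≤ C * ‖f‖ := by
    have hrt : Metric.closedBall y₀ r ⊆ c.target :=
      (Metric.closedBall_subset_closedBall hrR.le).trans hRt
    obtain ⟨C, hC⟩ := exists_norm_le_mul_norm_of_continuousOn hΩ N.subtypeL J hJc
      (fun f => (hJ f).2) (K := c.symm '' Metric.closedBall y₀ r) (U := c.symm '' Metric.ball y₀ r)
      ((isCompact_closedBall y₀ r).image_of_continuousOn (c.continuousOn_symm.mono hrt))
      (image_mono (Metric.closedBall_subset_ball hrR))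
      (c.isOpen_image_symm_of_subset_target Metric.isOpen_ball
        (Metric.ball_subset_closedBall.trans hrt))
      (image_mono Metric.ball_subset_closedBall)
    exact ⟨C, fun f y hy => hC f _ ⟨y, hy, rfl⟩⟩
  obtain ⟨C, hC⟩ := exists_norm_iteratedFDeriv_le_mul_norm J' hrR hJ' hbase m
  refine ⟨C, fun u hu y hy => ?_⟩
  have huc : ContinuousOn (fun x => (e ⟨x, u x⟩).2) K :=
    (contMDiffOn_trivializationAt_snd u x₀).continuousOn.mono hKe
  have hui : Integrable (fun x => (e ⟨x, u x⟩).2) (μ.restrict Ω) :=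
    (huc.integrableOn_compact hK).mono_set hΩK
  -- The coordinates of a classical solution form an element of `N`, whose smooth representative is
  -- then the coordinate function itself.
  have huN : hui.toL1 _ ∈ N := by
    rw [hN]
    intro φ
    have hsupp : secSupport (formalDualTest μ L Ω φ).1 ⊆ Ω := (formalDualTest μ L Ω φ).2.2
    have hint : ∫ x in Ω, (formalDualTest μ L Ω φ).1 x (u x) ∂μ = 0 := by
      rw [setIntegral_eq_integral_of_forall_compl_eq_zero fun x hx => by
        rw [eq_zero_of_notMem_secSupport fun h => hx (hsupp h)]; rfl]
      exact integral_formalDualTest_apply_eq_zero μ hu φ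
    rw [hT, ← hint]
    refine integral_congr_ae ?_
    filter_upwards [hui.coeFn_toL1, ae_restrict_mem hΩ.measurableSet] with x hx hxΩ
    rw [hx, dualBundle_apply_eq x₀ (hΩe hxΩ)]
  have hJu : EqOn (J' ⟨_, huN⟩) (coordRep V x₀ u) (Metric.ball y₀ R) := fun z hz =>
    huniq (hJc ⟨_, huN⟩) (huc.mono hΩK) ((hJ ⟨_, huN⟩).2.trans hui.coeFn_toL1) ⟨z, hz, rfl⟩
  have hev : J' ⟨_, huN⟩ =ᶠ[𝓝 y] coordRep V x₀ u :=
    hJu.eventuallyEq_of_mem (Metric.isOpen_ball.mem_nhds (Metric.ball_subset_ball hrR.le hy))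
  rw [← (hev.iteratedFDeriv ℝ m).eq_of_nhds]
  refine (hC _ y hy).trans_eq ?_
  rw [Submodule.coe_norm, L1.norm_eq_integral_norm]
  congr 1
  refine integral_congr_ae ?_
  filter_upwards [hui.coeFn_toL1] with x hx
  rw [hx]

end LocalEstimates

/-! ### Coordinate representations and chart points -/

section ChartCentres

variable {n : ℕ} {M : Type*} [TopologicalSpace M]
    [ChartedSpace (EuclideanSpace ℝ (Fin n)) M] {V : Type*} [NormedAddCommGroup V]
    {E : M → Type*} [TopologicalSpace (TotalSpace V E)]
    [∀ x, TopologicalSpace (E x)] [FiberBundle V E]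

theorem map_chartAt_mem_coordDomain (x : M) :
    chartAt (EuclideanSpace ℝ (Fin n)) x x ∈ coordDomain (n := n) V E x := by
  refine ⟨mem_chart_target _ x, ?_⟩
  rw [mem_preimage, (chartAt _ x).left_inv (mem_chart_source _ x)]
  exact FiberBundle.mem_baseSet_trivializationAt' x

theorem coordRep_chartAt (x₀ : M) {x : M} (hx : x ∈ (chartAt (EuclideanSpace ℝ (Fin n)) x₀).source)
    (s : ∀ x, E x) :
    coordRep (n := n) V x₀ s (chartAt (EuclideanSpace ℝ (Fin n)) x₀ x) =
      (trivializationAt V E x₀ ⟨x, s x⟩).2 := by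
  rw [coordRep, (chartAt _ x₀).left_inv hx]

end ChartCentres

/-! ### Montel's theorem for solutions -/

section Montel

variable {n : ℕ} {M : Type*} [TopologicalSpace M]
    [ChartedSpace (EuclideanSpace ℝ (Fin n)) M]
    {V : Type*} [NormedAddCommGroup V] [NormedSpace ℝ V]
    {E : M → Type*} [TopologicalSpace (TotalSpace V E)] [∀ x, AddCommGroup (E x)]
    [∀ x, Module ℝ (E x)] [∀ x, TopologicalSpace (E x)]
    [FiberBundle V E] [VectorBundle ℝ V E]
    {W : Type*} [NormedAddCommGroup W] [NormedSpace ℝ W]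
    {F : M → Type*} [TopologicalSpace (TotalSpace W F)] [∀ x, AddCommGroup (F x)]
    [∀ x, Module ℝ (F x)] [∀ x, TopologicalSpace (F x)]
    [FiberBundle W F] [VectorBundle ℝ W F]

/-- A family of sections is locally bounded together with all derivatives if so are its coordinate
representations. -/
def LocallyCInftyBounded {ι : Type*} (u : ι → SmoothSec (n := n) V E) : Prop :=
  ∀ x₀ : M, ∀ y₀ ∈ coordDomain (n := n) V E x₀, ∃ r > 0,
    Metric.ball y₀ r ⊆ coordDomain (n := n) V E x₀ ∧
    ∀ m : ℕ, ∃ C : ℝ, ∀ j, ∀ y ∈ Metric.ball y₀ r, ‖iteratedFDeriv ℝ m (coordRep V x₀ (u j)) y‖ ≤ C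

/-- Pointwise limits of solutions are solutions if all derivatives converge pointwise. -/
theorem IsDiffOp.mem_solutionSpace_of_tendsto {k : ℕ}
    {L : SmoothSec (n := n) V E →ₗ[ℝ] SmoothSec (n := n) W F} (hL : IsDiffOp k L)
    {ι : Type*} {l : Filter ι} [l.NeBot] {u : ι → SmoothSec (n := n) V E}
    {u₀ : SmoothSec (n := n) V E} (hu : ∀ j, u j ∈ solutionSpace L)
    (hlim : ∀ x₀ : M, ∀ y ∈ coordDomain (n := n) V E x₀, ∀ m : ℕ,
      Tendsto (fun j => iteratedFDeriv ℝ m (coordRep V x₀ (u j)) y) l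
        (𝓝 (iteratedFDeriv ℝ m (coordRep V x₀ u₀) y))) :
    u₀ ∈ solutionSpace L := by
  change L u₀ = 0
  refine ContMDiffSection.ext fun x => ?_
  obtain ⟨a, -, ha⟩ := hL x
  have hy : chartAt (EuclideanSpace ℝ (Fin n)) x x ∈
      coordDomain (n := n) V E x ∩ coordDomain (n := n) W F x :=
    ⟨map_chartAt_mem_coordDomain x, map_chartAt_mem_coordDomain x⟩
  have hxW : x ∈ (trivializationAt W F x).baseSet := FiberBundle.mem_baseSet_trivializationAt' x
  have hzero : ∀ s : SmoothSec (n := n) W F,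
      coordRep W x s (chartAt (EuclideanSpace ℝ (Fin n)) x x) = 0 ↔ s x = 0 := fun s => by
    rw [coordRep_chartAt x (mem_chart_source _ x)]
    exact trivializationAt_snd_eq_zero_iff x hxW _
  rw [ContMDiffSection.coe_zero, Pi.zero_apply, ← hzero]
  have h1 : Tendsto (fun j => coordRep W x (L (u j)) (chartAt (EuclideanSpace ℝ (Fin n)) x x)) l
      (𝓝 (coordRep W x (L u₀) (chartAt (EuclideanSpace ℝ (Fin n)) x x))) := by
    simp_rw [fun u => ha u _ hy]
    -- At a fixed point `L` is a finite sum of continuous linear maps of the derivatives.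
    exact tendsto_finsetSum _ fun m _ => ((a m _).continuous.tendsto _).comp (hlim x _ hy.1 m)
  have h2 : ∀ j, coordRep W x (L (u j)) (chartAt (EuclideanSpace ℝ (Fin n)) x x) = 0 := fun j => by
    rw [hzero, show L (u j) = 0 from hu j, ContMDiffSection.coe_zero, Pi.zero_apply]
  simp_rw [h2] at h1
  exact tendsto_nhds_unique h1 tendsto_const_nhds

variable [IsManifold (𝓡 n) ∞ M] [ContMDiffVectorBundle ∞ V E (𝓡 n)]

/-- A section whose coordinate representations are smooth is smooth. -/
theorem contMDiff_section_of_contDiffOn_coordRep {s : ∀ x, E x}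
    (hs : ∀ x₀ : M, ContDiffOn ℝ ∞ (coordRep (n := n) V x₀ s) (coordDomain (n := n) V E x₀)) :
    ContMDiff (𝓡 n) ((𝓡 n).prod 𝓘(ℝ, V)) ∞ (fun x => TotalSpace.mk' V x (s x)) := by
  intro x
  rw [Trivialization.contMDiffAt_section_iff (trivializationAt V E x)
    (FiberBundle.mem_baseSet_trivializationAt' x)]
  have h1 : ContMDiffAt 𝓘(ℝ, EuclideanSpace ℝ (Fin n)) 𝓘(ℝ, V) ∞ (coordRep (n := n) V x s)
      (chartAt (EuclideanSpace ℝ (Fin n)) x x) :=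
    ((hs x).contDiffAt ((isOpen_coordDomain x).mem_nhds
      (map_chartAt_mem_coordDomain x))).contMDiffAt
  have h2 : ContMDiffAt (𝓡 n) 𝓘(ℝ, EuclideanSpace ℝ (Fin n)) ∞
      (chartAt (EuclideanSpace ℝ (Fin n)) x) x :=
    (contMDiffOn_chart (I := 𝓡 n)).contMDiffAt
      ((chartAt (EuclideanSpace ℝ (Fin n)) x).open_source.mem_nhds (mem_chart_source _ x))
  refine (h1.comp x h2).congr_of_eventuallyEq ?_
  filter_upwards [(chartAt (EuclideanSpace ℝ (Fin n)) x).open_source.mem_nhds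
    (mem_chart_source _ x)] with z hz
  exact (coordRep_chartAt x hz s).symm

/-- The bound of order `m + 1` on a ball makes the derivatives of order `m` uniformly Lipschitz,
which upgrades pointwise to locally uniform convergence. -/
theorem LocallyCInftyBounded.tendstoCInfty {u : ℕ → SmoothSec (n := n) V E}
    (hu : LocallyCInftyBounded u) {u₀ : SmoothSec (n := n) V E}
    (hlim : ∀ x₀ : M, ∀ y ∈ coordDomain (n := n) V E x₀, ∀ m : ℕ,
      Tendsto (fun j => iteratedFDeriv ℝ m (coordRep V x₀ (u j)) y) atTop
        (𝓝 (iteratedFDeriv ℝ m (coordRep V x₀ u₀) y))) :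
    TendstoCInfty V u u₀ := fun x₀ m => by
  refine tendstoLocallyUniformlyOn_of_locally_lipschitz (fun y hy => ?_)
    fun y hy => hlim x₀ y hy m
  obtain ⟨r, hr, hsub, hC⟩ := hu x₀ y hy
  obtain ⟨C, hC⟩ := hC (m + 1)
  exact ⟨_, Metric.ball_mem_nhds y hr, C, fun j z hz =>
    norm_iteratedFDeriv_sub_le (contDiffOn_coordRep (u j) x₀) (isOpen_coordDomain x₀) hsub
      (convex_ball y r) (hC j) (Metric.mem_ball_self hr) hz⟩

variable [FiniteDimensional ℝ V]

/-- A locally `C^∞`-bounded family converges along every ultrafilter, with all derivatives. -/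
theorem LocallyCInftyBounded.exists_tendsto_ultrafilter {ι : Type*}
    {u : ι → SmoothSec (n := n) V E} (hu : LocallyCInftyBounded u) (U : Ultrafilter ι) :
    ∃ u₀ : SmoothSec (n := n) V E, (∀ x, Tendsto (fun j => u j x) U (𝓝 (u₀ x))) ∧
      ∀ x₀ : M, ∀ y ∈ coordDomain (n := n) V E x₀, ∀ m : ℕ,
        Tendsto (fun j => iteratedFDeriv ℝ m (coordRep V x₀ (u j)) y) U
          (𝓝 (iteratedFDeriv ℝ m (coordRep V x₀ u₀) y)) := by
  have hex : ∀ x : M, ∃ v : E x, Tendsto (fun j => u j x) U (𝓝 v) := fun x => by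
    obtain ⟨r, hr, -, hC⟩ := hu x _ (map_chartAt_mem_coordDomain x)
    obtain ⟨C, hC⟩ := hC 0
    have hx : x ∈ (trivializationAt V E x).baseSet := FiberBundle.mem_baseSet_trivializationAt' x
    let e := (trivializationAt V E x).continuousLinearEquivAt ℝ x hx
    have hle : ∀ j, ‖e (u j x)‖ ≤ C := fun j => by
      have h := hC j _ (Metric.mem_ball_self hr)
      rw [norm_iteratedFDeriv_zero, coordRep_chartAt x (mem_chart_source _ x)] at h
      exact h
    obtain ⟨v, hv⟩ := exists_tendsto_ultrafilter_of_norm_le U hle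
    refine ⟨e.symm v, ?_⟩
    exact ((e.symm.continuous.tendsto v).comp hv).congr fun j => e.symm_apply_apply (u j x)
  choose s hs using hex
  have hcoord : ∀ x₀ : M, ∀ y ∈ coordDomain (n := n) V E x₀,
      Tendsto (fun j => coordRep V x₀ (u j) y) U (𝓝 (coordRep V x₀ s y)) := fun x₀ y hy =>
    (((trivializationAt V E x₀).continuousLinearEquivAt ℝ _ hy.2).continuous.tendsto _).comp (hs _)
  have key : ∀ x₀ : M, ∀ y ∈ coordDomain (n := n) V E x₀,
      ContDiffAt ℝ ∞ (coordRep (n := n) V x₀ s) y ∧ ∀ m : ℕ,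
        Tendsto (fun j => iteratedFDeriv ℝ m (coordRep V x₀ (u j)) y) U
          (𝓝 (iteratedFDeriv ℝ m (coordRep V x₀ s) y)) := fun x₀ y hy => by
    obtain ⟨r, hr, hsub, hC⟩ := hu x₀ y hy
    obtain ⟨h1, h2⟩ := contDiffOn_and_tendsto_iteratedFDeriv_of_ultrafilter U Metric.isOpen_ball
      (convex_ball y r) (fun j => (contDiffOn_coordRep (u j) x₀).mono hsub) hC
      (fun z hz => hcoord x₀ z (hsub hz))
    exact ⟨h1.contDiffAt (Metric.ball_mem_nhds y hr), fun m => h2 m y (Metric.mem_ball_self hr)⟩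
  exact ⟨⟨s, contMDiff_section_of_contDiffOn_coordRep fun x₀ y hy =>
    (key x₀ y hy).1.contDiffWithinAt⟩, hs, fun x₀ y hy => (key x₀ y hy).2⟩

/-- Solutions of a weakly hypoelliptic equation that are locally bounded in `L¹` are locally
bounded together with all derivatives. -/
theorem WeaklyHypoelliptic.locallyCInftyBounded [T2Space M] [SecondCountableTopology M]
    [MeasurableSpace M] [BorelSpace M] {μ : Measure M} [IsLocallyFiniteMeasure μ]
    [μ.IsOpenPosMeasure] [∀ x, IsTopologicalAddGroup (E x)] [∀ x, ContinuousConstSMul ℝ (E x)]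
    {L : SmoothSec (n := n) V E →ₗ[ℝ] SmoothSec (n := n) W F} (hWH : WeaklyHypoelliptic μ L)
    (g : ContMDiffRiemannianMetric (𝓡 n) ∞ V E) {u : ℕ → SmoothSec (n := n) V E}
    (hu : ∀ j, u j ∈ solutionSpace L) (hbdd : LocallyL1Bounded μ g u) :
    LocallyCInftyBounded u := by
  intro x₀ y₀ hy₀
  set c := chartAt (EuclideanSpace ℝ (Fin n)) x₀
  obtain ⟨D, hD, hle⟩ := exists_norm_trivializationAt_le g x₀ hy₀.2
  have hnhds : coordDomain (n := n) V E x₀ ∩ c.symm ⁻¹' {x | ∀ v : E x,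
      ‖(trivializationAt V E x₀ ⟨x, v⟩).2‖ ≤ D * √(g.inner x v v)} ∈ 𝓝 y₀ :=
    inter_mem ((isOpen_coordDomain x₀).mem_nhds hy₀)
      ((c.continuousAt_symm hy₀.1).preimage_mem_nhds hle)
  -- The ball is small enough for the coordinate norm to be at most `D` times the Riemannian norm,
  -- which turns the `L¹` hypothesis into a bound on coordinates.
  obtain ⟨R, hR, hsub⟩ := Metric.nhds_basis_closedBall.mem_iff.1 hnhds
  have hRd : Metric.closedBall y₀ R ⊆ coordDomain (n := n) V E x₀ := fun y hy => (hsub hy).1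
  have hK : IsCompact (c.symm '' Metric.closedBall y₀ R) :=
    (isCompact_closedBall y₀ R).image_of_continuousOn
      (c.continuousOn_symm.mono fun y hy => (hRd hy).1)
  obtain ⟨B, hB⟩ := hbdd _ hK
  have hint : ∀ j, ∫ x in c.symm '' Metric.ball y₀ R, ‖(trivializationAt V E x₀ ⟨x, u j x⟩).2‖ ∂μ ≤
      D * B := fun j => by
    refine (Real.le_norm_self _).trans ((norm_integral_le_lintegral_norm _).trans ?_)
    refine ENNReal.toReal_le_of_le_ofReal (by positivity) ?_
    calc ∫⁻ x in c.symm '' Metric.ball y₀ R,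
          ENNReal.ofReal ‖‖(trivializationAt V E x₀ ⟨x, u j x⟩).2‖‖ ∂μ
        ≤ ∫⁻ x in c.symm '' Metric.closedBall y₀ R,
          ENNReal.ofReal ‖‖(trivializationAt V E x₀ ⟨x, u j x⟩).2‖‖ ∂μ :=
          lintegral_mono_set (image_mono Metric.ball_subset_closedBall)
      _ ≤ ∫⁻ x in c.symm '' Metric.closedBall y₀ R,
          ENNReal.ofReal D * ENNReal.ofReal √(g.inner x (u j x) (u j x)) ∂μ := by
          refine setLIntegral_mono' hK.measurableSet ?_
          rintro _ ⟨y, hy, rfl⟩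
          rw [norm_norm, ← ENNReal.ofReal_mul hD.le]
          exact ENNReal.ofReal_le_ofReal ((hsub hy).2 _)
      _ ≤ ENNReal.ofReal D * B := by
          rw [lintegral_const_mul' _ _ ENNReal.ofReal_ne_top]
          gcongr
          exact hB j
      _ = ENNReal.ofReal (D * B) := by
          rw [ENNReal.ofReal_mul hD.le, ENNReal.ofReal_coe_nnreal]
  -- The interior estimate needs a strictly smaller ball; `|C|` appears below because the sign of
  -- `C` is unknown.
  refine ⟨R / 2, half_pos hR, fun y hy => hRd (Metric.ball_subset_closedBall
    (Metric.ball_subset_ball (half_le_self hR.le) hy)), fun m => ?_⟩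
  obtain ⟨C, hC⟩ := hWH.exists_norm_iteratedFDeriv_coordRep_le x₀ (half_lt_self hR) hRd m
  refine ⟨|C| * (D * B), fun j y hy => (hC (u j) (hu j) y hy).trans ?_⟩
  exact mul_le_mul (le_abs_self C) (hint j) (integral_nonneg fun x => norm_nonneg _) (abs_nonneg C)

end Montel

/-! ### Convergence from a set of uniqueness -/

theorem theorem3p3 {n : ℕ} {M : Type*} [TopologicalSpace M] [T2Space M]
    [SecondCountableTopology M] [ChartedSpace (EuclideanSpace ℝ (Fin n)) M] [IsManifold (𝓡 n) ∞ M]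
    [MeasurableSpace M] [BorelSpace M] (μ : Measure M) (hμ : IsSmoothPositiveDensity n μ)
    {V : Type*} [NormedAddCommGroup V] [NormedSpace ℝ V] [FiniteDimensional ℝ V]
    {E : M → Type*} [TopologicalSpace (TotalSpace V E)] [∀ x, AddCommGroup (E x)]
    [∀ x, Module ℝ (E x)] [∀ x, TopologicalSpace (E x)]
    [∀ x, IsTopologicalAddGroup (E x)] [∀ x, ContinuousConstSMul ℝ (E x)]
    [FiberBundle V E] [VectorBundle ℝ V E] [ContMDiffVectorBundle ∞ V E (𝓡 n)]
    {W : Type*} [NormedAddCommGroup W] [NormedSpace ℝ W] [FiniteDimensional ℝ W]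
    {F : M → Type*} [TopologicalSpace (TotalSpace W F)] [∀ x, AddCommGroup (F x)]
    [∀ x, Module ℝ (F x)] [∀ x, TopologicalSpace (F x)]
    [FiberBundle W F] [VectorBundle ℝ W F] [ContMDiffVectorBundle ∞ W F (𝓡 n)]
    (g : ContMDiffRiemannianMetric (𝓡 n) ∞ V E)
    (k : ℕ) (L : SmoothSec (n := n) V E →ₗ[ℝ] SmoothSec (n := n) W F) (hL : IsDiffOp k L)
    (hWH : WeaklyHypoelliptic μ L)
    (A : Set M) (hA : IsSetOfUniqueness L A)
    (u : ℕ → SmoothSec (n := n) V E) (hu : ∀ j, u j ∈ solutionSpace L)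
    (hbdd : LocallyL1Bounded μ g u)
    (hlim : ∀ x ∈ A, ∃ l : E x, Tendsto (fun j => u j x) atTop (𝓝 l)) :
    ∃ u₀ ∈ solutionSpace L, TendstoCInfty V u u₀ := by
  have := hμ.isLocallyFiniteMeasure
  have := hμ.isOpenPosMeasure
  have hb : LocallyCInftyBounded u := hWH.locallyCInftyBounded g hu hbdd
  obtain ⟨u₀, hu₀, hu₀'⟩ := hb.exists_tendsto_ultrafilter (Ultrafilter.of atTop)
  have hu₀L : u₀ ∈ solutionSpace L := hL.mem_solutionSpace_of_tendsto hu hu₀'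
  -- Fibres are Hausdorff because they are homeomorphic to `V`; this gives uniqueness of the
  -- pointwise limits.
  have hT2 : ∀ x, T2Space (E x) := fun x =>
    ((trivializationAt V E x).continuousLinearEquivAt ℝ x
      (FiberBundle.mem_baseSet_trivializationAt' x)).toHomeomorph.isEmbedding.t2Space
  refine ⟨u₀, hu₀L, hb.tendstoCInfty fun x₀ y hy m => ?_⟩
  -- It suffices to show that every ultrafilter finer than `atTop` yields the same limit `u₀`.
  rw [tendsto_iff_ultrafilter]
  intro U hU
  obtain ⟨u₁, hu₁, hu₁'⟩ := hb.exists_tendsto_ultrafilter U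
  have hu₁L : u₁ ∈ solutionSpace L := hL.mem_solutionSpace_of_tendsto hu hu₁'
  have heq : u₁ = u₀ := by
    refine sub_eq_zero.1 (hA _ (sub_mem hu₁L hu₀L) fun x hx => ?_)
    obtain ⟨l, hl⟩ := hlim x hx
    rw [ContMDiffSection.coe_sub, Pi.sub_apply, sub_eq_zero,
      tendsto_nhds_unique (hu₁ x) (hl.mono_left hU),
      tendsto_nhds_unique (hu₀ x) (hl.mono_left (Ultrafilter.of_le atTop))]
  rw [← heq]
  exact hu₁' x₀ y hy m
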